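/- Let $n_+,n_-\geq 1$ be integers and $n:=n_++n_-$. Let $\lambda_1,\dots,\lambda_{n_+}\colon[0,\infty)\to(0,\infty)$ and $\theta_1,\dots,\theta_{n_-}\colon[0,\infty)\to(-\infty,0)$ be continuous functions such that $\frac{1}{\lambda_k}\notin L^1(0,\infty)$ and $\frac{1}{\theta_j}\notin L^1(0,\infty)$ for all $k=1,\dots,n_+$ and $j=1,\dots,n_-$. Put $\Lambda=\operatorname{diag}(\lambda_1,\dots,\lambda_{n_+})$, $\Theta=\operatorname{diag}(\theta_1,\dots,\theta_{n_-})$, $\Delta=\operatorname{diag}(\Lambda,\Theta)\colon[0,\infty)\to\mathbb{R}^{n\times n}$ and $|\Delta|=\operatorname{diag}(\lambda_1,\dots,\lambda_{n_+},|\theta_1|,\dots,|\theta_{n_-}|)$. Let $$L^2_{|\Delta|}(0,\infty)=\Bigl\{x\colon[0,\infty)\to\mathbb{C}^n \;;\; x\text{ measurable and } \|x\|^2:=\int_0^\infty x(\xi)^{\star}|\Delta(\xi)|x(\xi)\,\mathrm{d}\xi<\infty\Bigr\},$$ where functions that agree almost everywhere are identified. Then the operator $A_\Delta\colon D(A_\Delta)\to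 L^2_{|\Delta|}(0,\infty)$ given by $$A_\Delta x=(\Delta x)',$$ $$D(A_\Delta)=\bigl\{x\in L^2_{|\Delta|}(0,\infty)\;;\;\Delta x\in \mathrm{AC}_{\mathrm{loc}}[0,\infty),\ (\Delta x)'\in L^2_{|\Delta|}(0,\infty)\text{ and }(\Theta x)(0)=0\bigr\}$$ generates a $C_0$-semigroup on $L^2_{|\Delta|}(0,\infty)$. Here $\Delta x\in\mathrm{AC}_{\mathrm{loc}}[0,\infty)$ means that $\Delta x$ has a (necessarily unique) representative that is absolutely continuous on every compact interval $[a,b]\subseteq[0,\infty)$; $(\Delta x)'$ is its derivative, which exists almost everywhere, and $(\Theta x)(0)$ denotes the last $n_-$ components of the value of this representative at $0$. -/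

import Mathlib

open Set Filter Topology MeasureTheory
open scoped NNReal ENNReal Matrix

noncomputable section

namespace DiagTransport

/-! ## Strongly continuous semigroups and generators -/

/-- A `C₀`-semigroup of bounded linear operators on a complex normed space: `T 0 = id`,
`T (s + t) = T s ∘ T t`, and all orbits `t ↦ T t x`, `t ≥ 0`, are norm continuous. -/
structure C0Semigroup (X : Type*) [NormedAddCommGroup X] [NormedSpace ℂ X] where
  T : ℝ≥0 → X →L[ℂ] X
  map_zero : T 0 = ContinuousLinearMap.id ℂ X
  map_add : ∀ s t : ℝ≥0, T (s + t) = (T s).comp (T t)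
  continuous_orbit : ∀ x : X, Continuous fun t : ℝ≥0 => T t x

/-- The (unbounded) operator `A` is the infinitesimal generator of the semigroup `S`: `x` lies in
the domain of `A` with `A x = y` if and only if `(T t x - x) / t → y` in norm as `t ↘ 0`.
In particular the domain of `A` is exactly the set of those `x` for which the limit exists. -/
def C0Semigroup.IsGenerator {X : Type*} [NormedAddCommGroup X] [NormedSpace ℂ X]
    (S : C0Semigroup X) (A : X →ₗ.[ℂ] X) : Prop :=
  ∀ x y : X, (∃ hx : x ∈ A.domain, A ⟨x, hx⟩ = y) ↔
    Tendsto (fun t : ℝ≥0 => (((t : ℝ) : ℂ)⁻¹) • (S.T t x - x)) (𝓝[>] 0) (𝓝 y)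

/-- The operator `A` generates a `C₀`-semigroup. -/
def GeneratesC0Semigroup {X : Type*} [NormedAddCommGroup X] [NormedSpace ℂ X]
    (A : X →ₗ.[ℂ] X) : Prop :=
  ∃ S : C0Semigroup X, S.IsGenerator A

/-! ## The diagonal matrix functions -/

/-- The diagonal entries `λ_k : [0,∞) → (0,∞)` and `θ_j : [0,∞) → (-∞,0)`, continuous. A function
on `[0,∞)` is a function on `ℝ` of which only the values on `[0,∞)` are used. -/
structure DiagCoeff (p q : ℕ) where
  lam : Fin p → ℝ → ℝ
  theta : Fin q → ℝ → ℝ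
  lam_cont : ∀ k, ContinuousOn (lam k) (Ici 0)
  theta_cont : ∀ j, ContinuousOn (theta j) (Ici 0)
  lam_pos : ∀ k, ∀ ξ ∈ Ici (0 : ℝ), 0 < lam k ξ
  theta_neg : ∀ j, ∀ ξ ∈ Ici (0 : ℝ), theta j ξ < 0

/-- The index set of the `n = p + q` coordinates: first the positive, then the negative ones. -/
abbrev Idx (p q : ℕ) : Type := Fin p ⊕ Fin q

/-- A real matrix acting on a complex vector. -/
def act {ι : Type*} [Fintype ι] (M : Matrix ι ι ℝ) (v : ι → ℂ) : ι → ℂ :=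
  M.map Complex.ofReal *ᵥ v

/-- Lebesgue measure on `(0,∞)`. -/
abbrev vol0 : Measure ℝ := volume.restrict (Ioi 0)

namespace DiagCoeff

variable {p q : ℕ} (D : DiagCoeff p q)

/-- `Λ = diag(λ_1, …, λ_p)`. -/
def Lam (ξ : ℝ) : Matrix (Fin p) (Fin p) ℝ := Matrix.diagonal fun k => D.lam k ξ

/-- `Θ = diag(θ_1, …, θ_q)`. -/
def Theta (ξ : ℝ) : Matrix (Fin q) (Fin q) ℝ := Matrix.diagonal fun j => D.theta j ξ

/-- `Δ = diag(Λ, Θ)`. -/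
def Delta (ξ : ℝ) : Matrix (Idx p q) (Idx p q) ℝ :=
  Matrix.fromBlocks (D.Lam ξ) 0 0 (D.Theta ξ)

/-- `|Δ| = diag(λ_1, …, λ_p, |θ_1|, …, |θ_q|)`. -/
def absDelta (ξ : ℝ) : Matrix (Idx p q) (Idx p q) ℝ :=
  Matrix.diagonal (Sum.elim (fun k => D.lam k ξ) (fun j => |D.theta j ξ|))

/-- The density `x^* |Δ| y` at the point `ξ`. -/
def form (ξ : ℝ) (x y : Idx p q → ℂ) : ℂ := star x ⬝ᵥ act (D.absDelta ξ) y

/-- The diagonal entries of `|Δ|`. -/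
def wt (i : Idx p q) (ξ : ℝ) : ℝ :=
  Sum.elim (fun k => D.lam k ξ) (fun j => |D.theta j ξ|) i

/-- The square roots of the diagonal entries of `|Δ|`. -/
def rt (i : Idx p q) (ξ : ℝ) : ℂ := ((Real.sqrt (D.wt i ξ) : ℝ) : ℂ)

theorem wt_cont (i : Idx p q) : ContinuousOn (D.wt i) (Ici 0) := by
  rcases i with k | j
  · exact D.lam_cont k
  · exact (D.theta_cont j).abs

theorem wt_pos (i : Idx p q) {ξ : ℝ} (hξ : 0 ≤ ξ) : 0 < D.wt i ξ := by
  rcases i with k | j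
  · exact D.lam_pos k ξ hξ
  · exact abs_pos.2 (D.theta_neg j ξ hξ).ne

theorem rt_ne (i : Idx p q) {ξ : ℝ} (hξ : 0 ≤ ξ) : D.rt i ξ ≠ 0 :=
  Complex.ofReal_ne_zero.2 (Real.sqrt_pos.2 (D.wt_pos i hξ)).ne'

theorem rt_aesm (i : Idx p q) : AEStronglyMeasurable (D.rt i) vol0 :=
  ((Complex.continuous_ofReal.comp_continuousOn
    (Real.continuous_sqrt.comp_continuousOn (D.wt_cont i))).mono
      Ioi_subset_Ici_self).aestronglyMeasurable measurableSet_Ioi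

theorem ae_pos : ∀ᵐ ξ ∂vol0, (0 : ℝ) < ξ := ae_restrict_mem measurableSet_Ioi

theorem form_eq_sum {ξ : ℝ} (hξ : 0 ≤ ξ) (x y : Idx p q → ℂ) :
    D.form ξ x y = ∑ i, star (D.rt i ξ * x i) * (D.rt i ξ * y i) := by
  unfold form act absDelta dotProduct
  refine Finset.sum_congr rfl fun i _ => ?_
  rw [Matrix.diagonal_map (Complex.ofReal_zero), Matrix.mulVec_diagonal]
  have h : (D.rt i ξ) * (D.rt i ξ) = ((D.wt i ξ : ℝ) : ℂ) := by
    unfold rt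
    rw [← Complex.ofReal_mul, Real.mul_self_sqrt (D.wt_pos i hξ).le]
  have h2 : star (D.rt i ξ) = D.rt i ξ := Complex.conj_ofReal _
  have h3 : ((Sum.elim (fun k => D.lam k ξ) (fun j => |D.theta j ξ|) i : ℝ) : ℂ)
    = (D.rt i ξ) * (D.rt i ξ) := h.symm
  simp only [Pi.star_apply, star_mul, h2]
  rw [h3]; ring

theorem form_self_re {ξ : ℝ} (hξ : 0 ≤ ξ) (x : Idx p q → ℂ) :
    (D.form ξ x x).re = ∑ i, ‖D.rt i ξ * x i‖ ^ 2 := by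
  rw [D.form_eq_sum hξ, Complex.re_sum]
  refine Finset.sum_congr rfl fun i _ => ?_
  have := Complex.conj_mul' (D.rt i ξ * x i)
  rw [Complex.star_def, this, ← Complex.ofReal_pow, Complex.ofReal_re]

theorem comp_aesm (x : ℝ →ₘ[vol0] (Idx p q → ℂ)) (i : Idx p q) :
    AEStronglyMeasurable (fun ξ => D.rt i ξ * x ξ i) vol0 :=
  (D.rt_aesm i).mul ((continuous_apply i).comp_aestronglyMeasurable x.aestronglyMeasurable)

/-- The condition `∫_0^∞ x^* |Δ| x dξ < ∞`. -/
def FiniteEnergy (x : ℝ →ₘ[vol0] (Idx p q → ℂ)) : Prop :=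
  ∫⁻ ξ, ENNReal.ofReal (D.form ξ (x ξ) (x ξ)).re ∂vol0 < ∞

theorem finiteEnergy_iff (x : ℝ →ₘ[vol0] (Idx p q → ℂ)) :
    D.FiniteEnergy x ↔ ∀ i, MemLp (fun ξ => D.rt i ξ * x ξ i) 2 vol0 := by
  have h1 : ∫⁻ ξ, ENNReal.ofReal (D.form ξ (x ξ) (x ξ)).re ∂vol0
      = ∑ i, ∫⁻ ξ, ENNReal.ofReal (‖D.rt i ξ * x ξ i‖ ^ 2) ∂vol0 := by
    rw [← lintegral_finsetSum']
    · refine lintegral_congr_ae ?_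
      filter_upwards [ae_pos] with ξ hξ
      rw [D.form_self_re hξ.le, ENNReal.ofReal_sum_of_nonneg]
      intros; positivity
    · intro i _
      exact ((D.comp_aesm x i).norm.aemeasurable.pow_const 2).ennreal_ofReal
  unfold FiniteEnergy
  rw [h1, ENNReal.sum_lt_top]
  refine ⟨fun h i => ?_, fun h i _ => ?_⟩
  · rw [memLp_two_iff_integrable_sq_norm (D.comp_aesm x i)]
    refine ⟨((D.comp_aesm x i).norm.pow 2), ?_⟩
    rw [hasFiniteIntegral_iff_ofReal (Eventually.of_forall fun ξ => by positivity)]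
    exact h i (Finset.mem_univ i)
  · have := (memLp_two_iff_integrable_sq_norm (D.comp_aesm x i)).1 (h i)
    have h2 := this.2
    rwa [hasFiniteIntegral_iff_ofReal (Eventually.of_forall fun ξ => by positivity)] at h2

/-! ## The Hilbert space `L²_{|Δ|}(0,∞)` -/

/-- `L²_{|Δ|}(0,∞)` as a space of (a.e. classes of) measurable functions. -/
def L2Sub : Submodule ℂ (ℝ →ₘ[vol0] (Idx p q → ℂ)) where
  carrier := {x | D.FiniteEnergy x}
  zero_mem' := by
    rw [mem_ofPred_eq, finiteEnergy_iff]
    intro i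
    refine (MemLp.zero' (p := 2) (μ := vol0) (ε := ℂ)).ae_eq ?_
    filter_upwards [AEEqFun.coeFn_zero (μ := vol0) (α := ℝ) (β := Idx p q → ℂ)] with ξ h
    rw [h]; simp
  add_mem' := by
    intro x y hx hy
    rw [mem_ofPred_eq, finiteEnergy_iff] at *
    intro i
    refine ((hx i).add (hy i)).ae_eq ?_
    filter_upwards [AEEqFun.coeFn_add x y] with ξ h
    rw [h]; simp [mul_add]
  smul_mem' := by
    intro c x hx
    rw [mem_ofPred_eq, finiteEnergy_iff] at *
    intro i
    refine ((hx i).const_smul c).ae_eq ?_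
    filter_upwards [AEEqFun.coeFn_smul c x] with ξ h
    rw [h]; simp [mul_left_comm]

/-- `L²_{|Δ|}(0,∞)`: all measurable `x` with values in `ℂ^n`, up to equality almost everywhere,
such that `∫_0^∞ x^* |Δ| x dξ < ∞`. -/
def L2 : Type := D.L2Sub

instance : AddCommGroup D.L2 := inferInstanceAs (AddCommGroup D.L2Sub)
instance : Module ℂ D.L2 := inferInstanceAs (Module ℂ D.L2Sub)

/-- The function underlying an element of `L²_{|Δ|}(0,∞)` (a representative). -/
def fn (x : D.L2) : ℝ → Idx p q → ℂ := (x.1 : ℝ →ₘ[vol0] (Idx p q → ℂ))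

theorem fn_add (x y : D.L2) : ∀ᵐ ξ ∂vol0, D.fn (x + y) ξ = D.fn x ξ + D.fn y ξ :=
  AEEqFun.coeFn_add x.1 y.1

theorem fn_smul (c : ℂ) (x : D.L2) : ∀ᵐ ξ ∂vol0, D.fn (c • x) ξ = c • D.fn x ξ :=
  AEEqFun.coeFn_smul c x.1

theorem fn_zero : ∀ᵐ ξ ∂vol0, D.fn (0 : D.L2) ξ = 0 :=
  AEEqFun.coeFn_zero (μ := vol0) (α := ℝ) (β := Idx p q → ℂ)

theorem ext_ae {x y : D.L2} (h : ∀ᵐ ξ ∂vol0, D.fn x ξ = D.fn y ξ) : x = y :=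
  Subtype.ext (AEEqFun.ext h)

theorem memLp_fn (x : D.L2) (i : Idx p q) : MemLp (fun ξ => D.rt i ξ * D.fn x ξ i) 2 vol0 :=
  (D.finiteEnergy_iff x.1).1 x.2 i

theorem integrable_term (x y : D.L2) (i : Idx p q) :
    Integrable (fun ξ => star (D.rt i ξ * D.fn x ξ i) * (D.rt i ξ * D.fn y ξ i)) vol0 :=
  (D.memLp_fn x i).star.integrable_mul (D.memLp_fn y i)

theorem integrable_form (x y : D.L2) :
    Integrable (fun ξ => D.form ξ (D.fn x ξ) (D.fn y ξ)) vol0 := by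
  refine (integrable_finsetSum Finset.univ fun i _ => D.integrable_term x y i).congr ?_
  filter_upwards [ae_pos] with ξ hξ
  rw [D.form_eq_sum hξ.le]

/-- The scalar product `⟨x, y⟩ = ∫_0^∞ x^* |Δ| y dξ`. -/
def innerL2 (x y : D.L2) : ℂ := ∫ ξ, D.form ξ (D.fn x ξ) (D.fn y ξ) ∂vol0

theorem re_innerL2_self (x : D.L2) :
    (D.innerL2 x x).re = ∫ ξ, (D.form ξ (D.fn x ξ) (D.fn x ξ)).re ∂vol0 :=
  (integral_re (𝕜 := ℂ) (D.integrable_form x x)).symm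

/-- The scalar product turns `L²_{|Δ|}(0,∞)` into a pre-Hilbert space. -/
@[reducible] def innerCore : InnerProductSpace.Core ℂ D.L2 where
  inner := D.innerL2
  conj_inner_symm x y := by
    unfold innerL2
    rw [← integral_conj]
    refine integral_congr_ae ?_
    filter_upwards [ae_pos] with ξ hξ
    rw [D.form_eq_sum hξ.le, D.form_eq_sum hξ.le, map_sum]
    refine Finset.sum_congr rfl fun i _ => ?_
    simp only [Complex.star_def, map_mul, Complex.conj_conj]
    ring
  re_inner_nonneg x := by
    change 0 ≤ (D.innerL2 x x).re
    rw [re_innerL2_self]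
    refine integral_nonneg_of_ae ?_
    filter_upwards [ae_pos] with ξ hξ
    rw [D.form_self_re hξ.le]
    exact Finset.sum_nonneg fun i _ => by positivity
  add_left x y z := by
    unfold innerL2
    rw [← integral_add (D.integrable_form x z) (D.integrable_form y z)]
    refine integral_congr_ae ?_
    filter_upwards [D.fn_add x y] with ξ h
    simp only [form, h, star_add, add_dotProduct]
  smul_left x y c := by
    unfold innerL2
    rw [← integral_const_mul]
    refine integral_congr_ae ?_
    filter_upwards [D.fn_smul c x] with ξ h
    simp only [form, h, star_smul, smul_dotProduct]
    rfl
  definite x hx := by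
    have h1 : (D.innerL2 x x).re = 0 := by
      rw [show D.innerL2 x x = 0 from hx]; rfl
    have hre : Integrable (fun ξ => (D.form ξ (D.fn x ξ) (D.fn x ξ)).re) vol0 :=
      (D.integrable_form x x).re
    rw [re_innerL2_self, integral_eq_zero_iff_of_nonneg_ae _ hre] at h1
    · refine D.ext_ae ?_
      filter_upwards [h1, ae_pos, D.fn_zero] with ξ h hξ h0
      have h' : (D.form ξ (D.fn x ξ) (D.fn x ξ)).re = 0 := h
      rw [D.form_self_re hξ.le, Finset.sum_eq_zero_iff_of_nonneg (fun i _ => by positivity)] at h'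
      rw [h0]
      funext i
      have h2 := h' i (Finset.mem_univ i)
      simpa [D.rt_ne i hξ.le] using h2
    · filter_upwards [ae_pos] with ξ hξ
      rw [D.form_self_re hξ.le]
      exact Finset.sum_nonneg fun i _ => by positivity

instance : NormedAddCommGroup D.L2 := D.innerCore.toNormedAddCommGroup
instance : InnerProductSpace ℂ D.L2 := InnerProductSpace.ofCore D.innerCore.toCore

theorem norm_sq_eq (x : D.L2) :
    ‖x‖ ^ 2 = ∫ ξ, (D.form ξ (D.fn x ξ) (D.fn x ξ)).re ∂vol0 := by
  rw [← re_innerL2_self]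
  exact (inner_self_eq_norm_sq (𝕜 := ℂ) x).symm

/-- `x ↦ |Δ|^{1/2} x`, as a linear map into a finite sum of unweighted `L²`-spaces. -/
def sqrtMap : D.L2 →ₗ[ℂ] PiLp 2 (fun _ : Idx p q => Lp ℂ 2 vol0) where
  toFun x := WithLp.toLp 2 fun i => (D.memLp_fn x i).toLp _
  map_add' x y := by
    ext i : 1
    refine Lp.ext ?_
    rw [PiLp.add_apply]
    filter_upwards [(D.memLp_fn (x + y) i).coeFn_toLp, (D.memLp_fn x i).coeFn_toLp,
      (D.memLp_fn y i).coeFn_toLp, Lp.coeFn_add ((D.memLp_fn x i).toLp _)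
        ((D.memLp_fn y i).toLp _), D.fn_add x y] with ξ h1 h2 h3 h4 h5
    rw [h1, h4, Pi.add_apply, h2, h3, h5, Pi.add_apply, mul_add]
  map_smul' c x := by
    ext i : 1
    refine Lp.ext ?_
    rw [PiLp.smul_apply]
    filter_upwards [(D.memLp_fn (c • x) i).coeFn_toLp, (D.memLp_fn x i).coeFn_toLp,
      Lp.coeFn_smul c ((D.memLp_fn x i).toLp _), D.fn_smul c x] with ξ h1 h2 h4 h5
    simp only [RingHom.id_apply]
    rw [h1, h4, Pi.smul_apply, h2, h5, Pi.smul_apply, smul_eq_mul, smul_eq_mul, mul_left_comm]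

theorem norm_sqrtMap (x : D.L2) : ‖D.sqrtMap x‖ = ‖x‖ := by
  have h : ‖D.sqrtMap x‖ ^ 2 = ‖x‖ ^ 2 := by
    rw [PiLp.norm_sq_eq_of_L2, norm_sq_eq]
    have h1 : ∀ i, ‖(D.sqrtMap x) i‖ ^ 2 = ∫ ξ, ‖D.rt i ξ * D.fn x ξ i‖ ^ 2 ∂vol0 := by
      intro i
      rw [← inner_self_eq_norm_sq (𝕜 := ℂ), L2.inner_def]
      rw [← integral_re (L2.integrable_inner _ _)]
      refine integral_congr_ae ?_
      filter_upwards [(D.memLp_fn x i).coeFn_toLp] with ξ h1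
      rw [inner_self_eq_norm_sq (𝕜 := ℂ)]
      exact congrArg (fun z : ℂ => ‖z‖ ^ 2) h1
    simp_rw [h1]
    rw [← integral_finsetSum]
    · refine integral_congr_ae ?_
      filter_upwards [ae_pos] with ξ hξ
      rw [D.form_self_re hξ.le]
    · intro i _
      exact (memLp_two_iff_integrable_sq_norm (D.memLp_fn x i).1).1 (D.memLp_fn x i)
  exact (sq_eq_sq₀ (norm_nonneg _) (norm_nonneg _)).1 h

theorem sqrtMap_surjective : Function.Surjective D.sqrtMap := by
  intro g
  have hm : AEStronglyMeasurable (fun ξ => fun i : Idx p q => (D.rt i ξ)⁻¹ * g i ξ) vol0 := by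
    refine AEMeasurable.aestronglyMeasurable (aemeasurable_pi_lambda _ fun i => ?_)
    exact (D.rt_aesm i).aemeasurable.inv.mul (Lp.aestronglyMeasurable (g i)).aemeasurable
  have key : ∀ i, (fun ξ => D.rt i ξ * (AEEqFun.mk _ hm : ℝ →ₘ[vol0] (Idx p q → ℂ)) ξ i)
      =ᵐ[vol0] g i := by
    intro i
    filter_upwards [AEEqFun.coeFn_mk _ hm, ae_pos] with ξ h hξ
    rw [h, mul_inv_cancel_left₀ (D.rt_ne i hξ.le)]
  have hmem : D.FiniteEnergy (AEEqFun.mk _ hm) := by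
    rw [finiteEnergy_iff]
    exact fun i => (Lp.memLp (g i)).ae_eq (key i).symm
  refine ⟨(⟨AEEqFun.mk _ hm, hmem⟩ : D.L2Sub), ?_⟩
  ext i : 1
  refine Lp.ext ?_
  exact ((D.memLp_fn (⟨AEEqFun.mk _ hm, hmem⟩ : D.L2Sub) i).coeFn_toLp).trans (key i)

/-- `L²_{|Δ|}(0,∞)` is a Hilbert space. -/
instance : CompleteSpace D.L2 :=
  have e : D.L2 ≃ₗᵢ[ℂ] PiLp 2 (fun _ : Idx p q => Lp ℂ 2 vol0) :=
    LinearIsometryEquiv.ofSurjective ⟨D.sqrtMap, D.norm_sqrtMap⟩ D.sqrtMap_surjective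
  (completeSpace_congr (e := e.toLinearEquiv.toEquiv) e.isometry.isUniformEmbedding).2 inferInstance

/-! ## The operator `A_Δ x = (Δ x)'` -/

end DiagCoeff

/-- `y` is locally absolutely continuous on `[0,∞)`. -/
def ACLoc {ι : Type*} [Fintype ι] (y : ℝ → ι → ℂ) : Prop :=
  ∀ a b : ℝ, 0 ≤ a → a ≤ b → AbsolutelyContinuousOnInterval y a b

theorem ACLoc.continuousOn {ι : Type*} [Fintype ι] {y : ℝ → ι → ℂ} (h : ACLoc y) :
    ContinuousOn y (Ioi 0) := by
  intro ξ hξ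
  have h1 := (h 0 (ξ + 1) le_rfl (by linarith [mem_Ioi.1 hξ])).continuousOn
  refine (h1.continuousAt ?_).continuousWithinAt
  rw [uIcc_of_le (by linarith [mem_Ioi.1 hξ])]
  exact Icc_mem_nhds hξ (by linarith)

namespace DiagCoeff

variable {p q : ℕ} (D : DiagCoeff p q)

/-- `Δ x` has the locally absolutely continuous representative `y` on `[0,∞)`, the derivative
(almost everywhere) `(Δ x)' = y'` is `z ∈ L²_{|Δ|}(0,∞)`, and `(Θ x)(0) = 0`. -/
def IsDerivVia (x z : D.L2) (y : ℝ → Idx p q → ℂ) : Prop :=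
  ACLoc y ∧ (∀ᵐ ξ ∂vol0, y ξ = act (D.Delta ξ) (D.fn x ξ)) ∧
    (∀ᵐ ξ ∂vol0, HasDerivAt y (D.fn z ξ) ξ) ∧ ∀ j : Fin q, y 0 (Sum.inr j) = 0

theorem IsDerivVia.unique {D : DiagCoeff p q} {x z z' : D.L2} {y y' : ℝ → Idx p q → ℂ}
    (h : D.IsDerivVia x z y) (h' : D.IsDerivVia x z' y') : z = z' := by
  have hy : EqOn y y' (Ioi 0) := by
    refine Measure.eqOn_open_of_ae_eq (μ := volume) ?_ isOpen_Ioi h.1.continuousOn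
      h'.1.continuousOn
    filter_upwards [h.2.1, h'.2.1] with ξ h1 h2
    rw [h1, h2]
  refine D.ext_ae ?_
  filter_upwards [h.2.2.1, h'.2.2.1, ae_pos] with ξ h1 h2 hξ
  have h3 : y =ᶠ[𝓝 ξ] y' := by
    filter_upwards [Ioi_mem_nhds hξ] with η hη using hy hη
  exact (h1.congr_of_eventuallyEq h3.symm).unique h2

theorem isDerivVia_zero : D.IsDerivVia 0 0 0 := by
  refine ⟨fun a b _ _ => ?_, ?_, ?_, fun j => rfl⟩
  · exact (LipschitzWith.const (0 : Idx p q → ℂ)).lipschitzOnWith.absolutelyContinuousOnInterval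
  · filter_upwards [D.fn_zero] with ξ h
    simp [h, act]
  · filter_upwards [D.fn_zero] with ξ h
    rw [h]
    exact hasDerivAt_const ξ (0 : Idx p q → ℂ)

theorem IsDerivVia.add {D : DiagCoeff p q} {x z x' z' : D.L2} {y y' : ℝ → Idx p q → ℂ}
    (h : D.IsDerivVia x z y) (h' : D.IsDerivVia x' z' y') :
    D.IsDerivVia (x + x') (z + z') (y + y') := by
  refine ⟨fun a b h1 h2 => (h.1 a b h1 h2).add (h'.1 a b h1 h2), ?_, ?_, fun j => ?_⟩
  · filter_upwards [h.2.1, h'.2.1, D.fn_add x x'] with ξ h1 h2 h3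
    rw [Pi.add_apply, h1, h2, h3, act, act, act, Matrix.mulVec_add]
  · filter_upwards [h.2.2.1, h'.2.2.1, D.fn_add z z'] with ξ h1 h2 h3
    rw [h3]
    exact h1.add h2
  · rw [Pi.add_apply, Pi.add_apply, h.2.2.2 j, h'.2.2.2 j, add_zero]

theorem IsDerivVia.smul {D : DiagCoeff p q} {x z : D.L2} {y : ℝ → Idx p q → ℂ} (c : ℂ)
    (h : D.IsDerivVia x z y) : D.IsDerivVia (c • x) (c • z) (c • y) := by
  refine ⟨fun a b h1 h2 => (h.1 a b h1 h2).const_smul c, ?_, ?_, fun j => ?_⟩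
  · filter_upwards [h.2.1, D.fn_smul c x] with ξ h1 h3
    rw [Pi.smul_apply, h1, h3, act, act, Matrix.mulVec_smul]
  · filter_upwards [h.2.2.1, D.fn_smul c z] with ξ h1 h3
    rw [h3]
    exact h1.const_smul c
  · rw [Pi.smul_apply, Pi.smul_apply, h.2.2.2 j, smul_zero]

/-- `D(A_Δ) = {x ∈ L²_{|Δ|}(0,∞) ; Δ x ∈ AC_loc[0,∞), (Δ x)' ∈ L²_{|Δ|}(0,∞), (Θ x)(0) = 0}`. -/
def domA : Submodule ℂ D.L2 where
  carrier := {x | ∃ (z : D.L2) (y : ℝ → Idx p q → ℂ), D.IsDerivVia x z y}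
  zero_mem' := ⟨0, 0, D.isDerivVia_zero⟩
  add_mem' := by
    rintro x x' ⟨z, y, h⟩ ⟨z', y', h'⟩
    exact ⟨z + z', y + y', h.add h'⟩
  smul_mem' := by
    rintro c x ⟨z, y, h⟩
    exact ⟨c • z, c • y, h.smul c⟩

/-- The operator `A_Δ x = (Δ x)'` with domain `D(A_Δ)`. -/
def opA : D.L2 →ₗ.[ℂ] D.L2 where
  domain := D.domA
  toFun :=
    { toFun := fun x => x.2.choose
      map_add' := fun x x' => by
        obtain ⟨y, h⟩ := x.2.choose_spec
        obtain ⟨y', h'⟩ := x'.2.choose_spec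
        obtain ⟨y'', h''⟩ := (x + x').2.choose_spec
        exact h''.unique (h.add h')
      map_smul' := fun c x => by
        obtain ⟨y, h⟩ := x.2.choose_spec
        obtain ⟨y'', h''⟩ := (c • x).2.choose_spec
        exact h''.unique (h.smul c) }

/-- `x ∈ D(A_Δ)` and `A_Δ x = z` if and only if `z` is the derivative `(Δ x)'`. -/
theorem opA_iff (x z : D.L2) :
    (∃ hx : x ∈ D.opA.domain, D.opA ⟨x, hx⟩ = z) ↔ ∃ y, D.IsDerivVia x z y := by
  constructor
  · rintro ⟨hx, rfl⟩
    exact hx.choose_spec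
  · rintro ⟨y, h⟩
    have hx : x ∈ D.opA.domain := ⟨z, y, h⟩
    obtain ⟨y', h'⟩ := Exists.choose_spec hx
    exact ⟨hx, h'.unique h⟩

end DiagCoeff

end DiagTransport

end

/-! The components decouple, and each one is a pure transport equation. Put σ = ±1 for the sign of
the i-th diagonal entry δ of Δ, and measure position by the travel time τ(ξ) = ∫_0^ξ 1/|δ|. Since
1/δ is continuous but not integrable, τ is a bijection of [0,∞). Writing f(τ(ξ)) = δ(ξ) x_i(ξ), the
substitution gives ∫ |f|² dτ = ∫ |δ| |x_i|² dξ, so x_i ↦ f is isometric onto the unweighted L²(0,∞).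
It turns x_i ↦ (δ x_i)' into f ↦ σ f', with the condition f(0) = 0 exactly when σ = -1.

On L²(0,∞), σ d/dτ generates the translations f ↦ f(· + σt): to the left with mass leaving at 0 when
σ = 1, to the right with zero inflow when σ = -1. Both inclusions between generator and derivative
are proved directly, without resolvents. If f is a primitive of σg, the difference quotient is an
average of translates of g and tends to g by strong continuity (`IsPrimitive.orbitDeriv`). If the
quotient converges to g, integrating it over (0,b) and applying Lebesgue differentiation recovers f
as a primitive (`isPrimitive_of_orbitDeriv`).

The product of these semigroups, conjugated by `charEquiv`, is the required semigroup. Because "x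
lies in the domain with image z" is carried through equivalences (`exists_isDerivVia_iff`,
`isPrimitive_charEquiv`, `orbitDeriv_shiftSemigroup`), the domain is identified at the same time as
the action. -/

noncomputable section

namespace DiagTransport

/-! ## Semigroups: orbit derivatives, products and similarity -/

section Abstract

variable {X Y : Type*} [NormedAddCommGroup X] [NormedSpace ℂ X]
  [NormedAddCommGroup Y] [NormedSpace ℂ Y]

/-- The orbit of `x` has the right derivative `y` at time zero. -/
def C0Semigroup.OrbitDeriv (S : C0Semigroup X) (x y : X) : Prop :=
  Tendsto (fun t : ℝ≥0 => (((t : ℝ) : ℂ)⁻¹) • (S.T t x - x)) (𝓝[>] 0) (𝓝 y)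

/-- The product of finitely many semigroups. -/
def C0Semigroup.pi {ι : Type*} [Fintype ι] (S : ι → C0Semigroup X) : C0Semigroup (ι → X) where
  T t := ContinuousLinearMap.pi fun i => ((S i).T t).comp (ContinuousLinearMap.proj i)
  map_zero := by
    ext x i
    simp [(S i).map_zero]
  map_add s t := by
    ext x i
    simp [(S i).map_add]
  continuous_orbit x := continuous_pi fun i => (S i).continuous_orbit (x i)

theorem C0Semigroup.orbitDeriv_pi {ι : Type*} [Fintype ι] (S : ι → C0Semigroup X) (x y : ι → X) :
    (C0Semigroup.pi S).OrbitDeriv x y ↔ ∀ i, (S i).OrbitDeriv (x i) (y i) :=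
  tendsto_pi_nhds

/-- A semigroup transported along a continuous linear equivalence. -/
def C0Semigroup.conj (e : X ≃L[ℂ] Y) (S : C0Semigroup Y) : C0Semigroup X where
  T t := (e.symm : Y →L[ℂ] X).comp ((S.T t).comp (e : X →L[ℂ] Y))
  map_zero := by
    ext x
    simp [S.map_zero]
  map_add s t := by
    ext x
    simp [S.map_add]
  continuous_orbit x := e.symm.continuous.comp (S.continuous_orbit (e x))

theorem C0Semigroup.orbitDeriv_conj (e : X ≃L[ℂ] Y) (S : C0Semigroup Y) (x y : X) :
    (S.conj e).OrbitDeriv x y ↔ S.OrbitDeriv (e x) (e y) := by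
  unfold OrbitDeriv
  -- As `e` is a homeomorphism, convergence can be tested after applying it, where the conjugation
  -- cancels.
  rw [e.toHomeomorph.isInducing.tendsto_nhds_iff]
  have h : (e.toHomeomorph ∘ fun t : ℝ≥0 => (((t : ℝ) : ℂ)⁻¹) • ((S.conj e).T t x - x))
      = fun t : ℝ≥0 => (((t : ℝ) : ℂ)⁻¹) • (S.T t (e x) - e x) := by
    funext t
    simp [C0Semigroup.conj]
  rw [h]
  rfl

end Abstract

/-! ## Translations on `L²(0,∞)` -/

theorem memLp_indicator_Ioi (f : Lp ℂ 2 vol0) :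
    MemLp ((Ioi (0 : ℝ)).indicator f) 2 (volume : Measure ℝ) :=
  (memLp_indicator_iff_restrict measurableSet_Ioi).2 (Lp.memLp f)

/-- The class of the extension by zero from `(0,∞)` to `ℝ`. -/
def zeroExtFun (f : Lp ℂ 2 vol0) : Lp ℂ 2 (volume : Measure ℝ) :=
  (memLp_indicator_Ioi f).toLp _

theorem coeFn_zeroExtFun (f : Lp ℂ 2 vol0) :
    zeroExtFun f =ᵐ[volume] (Ioi (0 : ℝ)).indicator f :=
  MemLp.coeFn_toLp (memLp_indicator_Ioi f)

theorem norm_zeroExtFun (f : Lp ℂ 2 vol0) : ‖zeroExtFun f‖ = ‖f‖ := by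
  rw [zeroExtFun, Lp.norm_toLp, eLpNorm_indicator_eq_eLpNorm_restrict measurableSet_Ioi,
    Lp.norm_def]

theorem zeroExtFun_add (f g : Lp ℂ 2 vol0) :
    zeroExtFun (f + g) = zeroExtFun f + zeroExtFun g := by
  refine Lp.ext ?_
  have h := (ae_restrict_iff' (μ := volume) measurableSet_Ioi).1 (Lp.coeFn_add f g)
  filter_upwards [coeFn_zeroExtFun (f + g), coeFn_zeroExtFun f, coeFn_zeroExtFun g,
    Lp.coeFn_add (zeroExtFun f) (zeroExtFun g), h] with τ h1 h2 h3 h4 h5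
  rw [h1, h4, Pi.add_apply, h2, h3]
  by_cases hτ : τ ∈ Ioi (0 : ℝ)
  · simp only [indicator_of_mem hτ, h5 hτ, Pi.add_apply]
  · simp only [indicator_of_notMem hτ, add_zero]

theorem zeroExtFun_smul (c : ℂ) (f : Lp ℂ 2 vol0) :
    zeroExtFun (c • f) = c • zeroExtFun f := by
  refine Lp.ext ?_
  have h := (ae_restrict_iff' (μ := volume) measurableSet_Ioi).1 (Lp.coeFn_smul c f)
  filter_upwards [coeFn_zeroExtFun (c • f), coeFn_zeroExtFun f,
    Lp.coeFn_smul c (zeroExtFun f), h] with τ h1 h2 h4 h5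
  rw [h1, h4, Pi.smul_apply, h2]
  by_cases hτ : τ ∈ Ioi (0 : ℝ)
  · simp only [indicator_of_mem hτ, h5 hτ, Pi.smul_apply]
  · simp only [indicator_of_notMem hτ, smul_zero]

/-- Extension by zero from `(0,∞)` to `ℝ`. -/
def zeroExt : Lp ℂ 2 vol0 →L[ℂ] Lp ℂ 2 (volume : Measure ℝ) :=
  LinearMap.mkContinuous ⟨⟨zeroExtFun, zeroExtFun_add⟩, zeroExtFun_smul⟩ 1
    fun f => by rw [one_mul]; exact (norm_zeroExtFun f).le

theorem coeFn_zeroExt (f : Lp ℂ 2 vol0) : zeroExt f =ᵐ[volume] (Ioi (0 : ℝ)).indicator f :=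
  coeFn_zeroExtFun f

/-- Restriction from `ℝ` to `(0,∞)`. -/
def restr : Lp ℂ 2 (volume : Measure ℝ) →L[ℂ] Lp ℂ 2 vol0 :=
  LpToLpRestrictCLM ℝ ℂ ℂ volume 2 (Ioi 0)

theorem coeFn_restr (f : Lp ℂ 2 (volume : Measure ℝ)) : restr f =ᵐ[vol0] f :=
  LpToLpRestrictCLM_coeFn ℂ (Ioi 0) f

/-- Translation by `a` on `L²(ℝ)`. -/
def translate (a : ℝ) : Lp ℂ 2 (volume : Measure ℝ) →L[ℂ] Lp ℂ 2 (volume : Measure ℝ) :=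
  (Lp.compMeasurePreservingₗᵢ ℂ (fun τ : ℝ => τ + a)
    (measurePreserving_add_right volume a)).toContinuousLinearMap

theorem coeFn_translate (a : ℝ) (f : Lp ℂ 2 (volume : Measure ℝ)) :
    translate a f =ᵐ[volume] fun τ => f (τ + a) :=
  Lp.coeFn_compMeasurePreserving f (measurePreserving_add_right volume a)

/-- Strong continuity: a ↦ (τ ↦ τ + a) is continuous into C(ℝ, ℝ) by currying, and composition with
measure preserving maps depends continuously on the map in L^p for p < ∞. -/
theorem continuous_translate (f : Lp ℂ 2 (volume : Measure ℝ)) :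
    Continuous fun a => translate a f := by
  let F : C(ℝ × ℝ, ℝ) := ⟨fun x => x.2 + x.1, by fun_prop⟩
  exact Continuous.compMeasurePreservingLp (g := fun a : ℝ => F.curry a)
    (f := fun _ => f) continuous_const F.curry.continuous
    (fun a => measurePreserving_add_right volume a) (by simp)

theorem ae_comp_add {P : ℝ → Prop} (h : ∀ᵐ τ : ℝ, P τ) (a : ℝ) : ∀ᵐ τ : ℝ, P (τ + a) :=
  (measurePreserving_add_right volume a).quasiMeasurePreserving.ae h

/-- The translation `f ↦ f(· + a)` on `L²(0,∞)`, functions being extended by zero. -/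
def shift (a : ℝ) : Lp ℂ 2 vol0 →L[ℂ] Lp ℂ 2 vol0 :=
  restr.comp ((translate a).comp zeroExt)

theorem coeFn_shift (a : ℝ) (f : Lp ℂ 2 vol0) :
    ∀ᵐ τ, 0 < τ → shift a f τ = (Ioi (0 : ℝ)).indicator f (τ + a) := by
  have h := (ae_restrict_iff' (μ := volume) measurableSet_Ioi).1
    (coeFn_restr (translate a (zeroExt f)))
  filter_upwards [h, coeFn_translate a (zeroExt f), ae_comp_add (coeFn_zeroExt f) a]
    with τ h1 h2 h3 hτ
  rw [← h3, ← h2]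
  exact h1 hτ

/-- The left (`σ = 1`) and right (`σ = -1`) translation semigroups on `L²(0,∞)`. -/
def shiftSemigroup (σ : ℝ) (hσ : σ = 1 ∨ σ = -1) : C0Semigroup (Lp ℂ 2 vol0) where
  T t := shift (σ * t)
  map_zero := by
    ext1 f
    refine Lp.ext ?_
    rw [Filter.EventuallyEq, ae_restrict_iff' measurableSet_Ioi]
    filter_upwards [coeFn_shift (σ * (0 : ℝ≥0)) f] with τ h hτ
    rw [h hτ]
    simp [indicator_of_mem hτ]
  map_add s t := by
    ext1 f
    refine Lp.ext ?_
    rw [Filter.EventuallyEq, ae_restrict_iff' measurableSet_Ioi]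
    filter_upwards [coeFn_shift (σ * (s + t : ℝ≥0)) f,
      coeFn_shift (σ * s) (shift (σ * t) f),
      ae_comp_add (coeFn_shift (σ * t) f) (σ * s)] with τ h1 h2 h3 hτ
    rw [h1 hτ, ContinuousLinearMap.comp_apply, h2 hτ]
    have hs := s.2
    have ht := t.2
    have hτ' : 0 < τ := hτ
    have e : τ + σ * ((s + t : ℝ≥0) : ℝ) = τ + σ * s + σ * t := by push_cast; ring
    rw [e]
    by_cases h4 : 0 < τ + σ * s
    · rw [indicator_of_mem (mem_Ioi.2 h4), h3 h4]
    -- The characteristic has already left the half line; this forces σ = -1, and a further shift by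
    -- σt only moves it further to the left, so both sides vanish.
    · rw [indicator_of_notMem (s := Ioi (0 : ℝ)) (a := τ + σ * s) h4, indicator_of_notMem]
      rw [mem_Ioi]
      rcases hσ with rfl | rfl
      · exact absurd (by simp only [NNReal.val_eq_coe] at hs; linarith) h4
      · simp only [NNReal.val_eq_coe] at ht; linarith
  continuous_orbit f := restr.continuous.comp
    ((continuous_translate (zeroExt f)).comp
      (continuous_const.mul NNReal.continuous_coe))

/-! ## The generators of the translation semigroups -/

/-- Cauchy–Schwarz against the constant 1. -/
theorem sq_lintegral_le {α : Type*} [MeasurableSpace α] (μ : Measure α) {f : α → ℝ≥0∞}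
    (hf : AEMeasurable f μ) : (∫⁻ x, f x ∂μ) ^ 2 ≤ (∫⁻ x, f x ^ 2 ∂μ) * μ univ := by
  have h := ENNReal.lintegral_mul_le_Lp_mul_Lq μ (Real.HolderConjugate.two_two) hf
    (aemeasurable_const (b := (1 : ℝ≥0∞)))
  simp only [Pi.mul_apply, mul_one, ENNReal.rpow_two, one_pow, lintegral_one] at h
  calc (∫⁻ x, f x ∂μ) ^ 2 ≤ ((∫⁻ x, f x ^ 2 ∂μ) ^ (1 / 2 : ℝ) * μ univ ^ (1 / 2 : ℝ)) ^ 2 := by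
        gcongr
    _ = _ := by
        rw [mul_pow, ← ENNReal.rpow_two, ← ENNReal.rpow_two, ← ENNReal.rpow_mul,
          ← ENNReal.rpow_mul]
        norm_num

theorem eLpNorm_two_sq {α : Type*} [MeasurableSpace α] (μ : Measure α) (f : α → ℂ) :
    eLpNorm f 2 μ ^ 2 = ∫⁻ x, ‖f x‖ₑ ^ 2 ∂μ := by
  have h := eLpNorm_nnreal_pow_eq_lintegral (f := f) (μ := μ) (p := 2) two_ne_zero
  simpa [ENNReal.rpow_two] using h

/-- Minkowski's inequality for the integrated translation differences. -/
theorem eLpNorm_integral_translate_sub_le (G : Lp ℂ 2 (volume : Measure ℝ)) (σ : ℝ) {t M : ℝ}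
    (ht : 0 ≤ t) (hM : ∀ s ∈ Ioc 0 t, ‖translate (σ * s) G - G‖ ≤ M) :
    eLpNorm (fun τ => ∫ s in 0..t, (G (τ + σ * s) - G τ)) 2 volume ≤ ENNReal.ofReal (t * M) := by
  have hGm : Measurable G := (Lp.stronglyMeasurable G).measurable
  have hk : Measurable (fun z : ℝ × ℝ => ‖G (z.1 + σ * z.2) - G z.1‖ₑ ^ 2) := by fun_prop
  rw [← ENNReal.pow_le_pow_left_iff two_ne_zero, eLpNorm_two_sq]
  -- Cauchy–Schwarz in s costs a factor t; Tonelli then exposes ‖translate G - G‖² for each s, and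
  -- integrating M² over (0,t] gives the second factor t.
  calc ∫⁻ τ, ‖∫ s in 0..t, (G (τ + σ * s) - G τ)‖ₑ ^ 2
      ≤ ∫⁻ τ, (∫⁻ s in Ioc 0 t, ‖G (τ + σ * s) - G τ‖ₑ ^ 2) * ENNReal.ofReal t := by
        refine lintegral_mono fun τ => ?_
        rw [intervalIntegral.integral_of_le ht]
        refine (pow_le_pow_left' (enorm_integral_le_lintegral_enorm _) 2).trans ?_
        refine (sq_lintegral_le _ (by fun_prop)).trans ?_
        simp
    _ = (∫⁻ s in Ioc 0 t, ∫⁻ τ, ‖G (τ + σ * s) - G τ‖ₑ ^ 2) * ENNReal.ofReal t := by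
        rw [lintegral_mul_const' _ _ ENNReal.ofReal_ne_top, lintegral_lintegral_swap]
        exact hk.aemeasurable
    _ ≤ (∫⁻ s in Ioc 0 t, ENNReal.ofReal M ^ 2) * ENNReal.ofReal t := by
        gcongr ?_ * _
        refine setLIntegral_mono measurable_const fun s hs => ?_
        have h1 : ∫⁻ τ, ‖G (τ + σ * s) - G τ‖ₑ ^ 2
            = ∫⁻ τ, ‖(translate (σ * s) G - G : Lp ℂ 2 (volume : Measure ℝ)) τ‖ₑ ^ 2 := by
          refine lintegral_congr_ae ?_
          filter_upwards [Lp.coeFn_sub (translate (σ * s) G) G, coeFn_translate (σ * s) G]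
            with τ h1 h2
          rw [h1, Pi.sub_apply, h2]
        rw [h1, ← eLpNorm_two_sq, ← Lp.enorm_def, ← ofReal_norm]
        gcongr
        exact hM s hs
    _ = ENNReal.ofReal (t * M) ^ 2 := by
        rw [setLIntegral_const, Real.volume_Ioc, sub_zero, ENNReal.ofReal_mul ht]
        ring

theorem intervalIntegrable_coeFn (G : Lp ℂ 2 (volume : Measure ℝ)) (a b : ℝ) :
    IntervalIntegrable G volume a b :=
  intervalIntegrable_iff.2 ((((Lp.memLp G).locallyIntegrable (by norm_num)).integrableOn_isCompact
    isCompact_uIcc).mono_set uIoc_subset_uIcc)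

theorem integral_zeroExt_of_nonneg (g : Lp ℂ 2 vol0) {τ : ℝ} (hτ : 0 ≤ τ) :
    ∫ s in 0..τ, zeroExt g s = ∫ s in 0..τ, g s := by
  refine intervalIntegral.integral_congr_ae ?_
  filter_upwards [coeFn_zeroExt g] with s hs hs'
  rw [uIoc_of_le hτ] at hs'
  rw [hs, indicator_of_mem (mem_Ioi.2 hs'.1)]

theorem integral_zeroExt_of_nonpos (g : Lp ℂ 2 vol0) {τ : ℝ} (hτ : τ ≤ 0) :
    ∫ s in 0..τ, zeroExt g s = 0 := by
  refine intervalIntegral.integral_zero_ae ?_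
  filter_upwards [coeFn_zeroExt g] with s hs hs'
  rw [uIoc_of_ge hτ] at hs'
  rw [hs, indicator_of_notMem (s := Ioi (0 : ℝ)) (not_lt.2 hs'.2)]

theorem integral_comp_shift (G : ℝ → ℂ) {σ : ℝ} (hσ : σ = 1 ∨ σ = -1) (τ t : ℝ) :
    ∫ s in 0..t, G (τ + σ * s) = σ * ∫ s in τ..(τ + σ * t), G s := by
  rcases hσ with rfl | rfl
  · simp
  · have h := intervalIntegral.integral_comp_sub_left G τ (a := 0) (b := t)
    simp only [neg_mul, one_mul, ← sub_eq_add_neg, h, sub_zero]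
    rw [intervalIntegral.integral_symm]
    push_cast
    ring

/-- `f` is locally absolutely continuous on `[0,∞)` with `σ f' = g`, and `f 0 = 0` if `σ = -1`. -/
def IsPrimitive (σ : ℝ) (f g : Lp ℂ 2 vol0) : Prop :=
  ∃ c : ℂ, (σ = -1 → c = 0) ∧ ∀ᵐ τ : ℝ, 0 < τ → f τ = c + σ * ∫ s in 0..τ, g s

/-- The fundamental theorem of calculus along a characteristic. The boundary condition is what keeps
it valid when the characteristic crosses 0. -/
theorem IsPrimitive.shift_sub {σ : ℝ} (hσ : σ = 1 ∨ σ = -1) {f g : Lp ℂ 2 vol0}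
    (h : IsPrimitive σ f g) {t : ℝ} (ht : 0 ≤ t) :
    ∀ᵐ τ : ℝ, 0 < τ → shift (σ * t) f τ - f τ = ∫ s in 0..t, zeroExt g (τ + σ * s) := by
  obtain ⟨c, hc, h⟩ := h
  have hI := intervalIntegrable_coeFn (zeroExt g)
  filter_upwards [coeFn_shift (σ * t) f, h, ae_comp_add h (σ * t)] with τ h1 h2 h3 hτ
  -- The zero extension of f is still given by the primitive formula: left of 0 the integral of
  -- `zeroExt g` vanishes, and such a point is reached only for σ = -1, where c = 0.
  have e1 : (Ioi (0 : ℝ)).indicator f (τ + σ * t)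
      = c + σ * ∫ s in 0..(τ + σ * t), zeroExt g s := by
    by_cases h4 : 0 < τ + σ * t
    · rw [indicator_of_mem (mem_Ioi.2 h4), h3 h4, integral_zeroExt_of_nonneg g h4.le]
    · rw [indicator_of_notMem (s := Ioi (0 : ℝ)) h4, integral_zeroExt_of_nonpos g (not_lt.1 h4)]
      rcases hσ with rfl | rfl
      · exact absurd (by linarith) h4
      · simp [hc rfl]
  rw [h1 hτ, e1, h2 hτ, ← integral_zeroExt_of_nonneg g hτ.le, integral_comp_shift _ hσ,
    ← intervalIntegral.integral_interval_sub_left (hI 0 (τ + σ * t)) (hI 0 τ)]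
  ring

theorem IsPrimitive.orbitDeriv {σ : ℝ} (hσ : σ = 1 ∨ σ = -1) {f g : Lp ℂ 2 vol0}
    (h : IsPrimitive σ f g) : (shiftSemigroup σ hσ).OrbitDeriv f g := by
  -- The error of the difference quotient is the mean over s ∈ (0,t] of the translation errors of g,
  -- hence is bounded by any common bound M for them.
  have hbound : ∀ {t M : ℝ}, 0 < t → 0 ≤ M →
      (∀ s ∈ Ioc 0 t, ‖translate (σ * s) (zeroExt g) - zeroExt g‖ ≤ M) →
      ‖((t : ℂ)⁻¹) • (shift (σ * t) f - f) - g‖ ≤ M := by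
    intro t M ht hM0 hM
    have h1 : ‖(shift (σ * t) f - f) - (t : ℂ) • g‖ ≤ t * M := by
      rw [Lp.norm_def]
      refine ENNReal.toReal_le_of_le_ofReal (by positivity) (le_trans ?_
        ((eLpNorm_mono_measure (ν := volume.restrict (Ioi (0 : ℝ))) _ Measure.restrict_le_self).trans
          (eLpNorm_integral_translate_sub_le (zeroExt g) σ ht.le hM)))
      refine (eLpNorm_congr_ae ?_).le
      filter_upwards [Lp.coeFn_sub (shift (σ * t) f - f) ((t : ℂ) • g),
        Lp.coeFn_sub (shift (σ * t) f) f, Lp.coeFn_smul (t : ℂ) g, DiagCoeff.ae_pos,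
        ae_restrict_of_ae (h.shift_sub hσ ht.le), ae_restrict_of_ae (coeFn_zeroExt g)] with τ h1 h2 h3 hτ h5 h6
      have hint : IntervalIntegrable (fun s => zeroExt g (τ + σ * s)) volume 0 t := by
        have hG := intervalIntegrable_coeFn (zeroExt g)
        rcases hσ with rfl | rfl
        · simpa using (hG τ (τ + t)).comp_add_left τ
        · simpa [← sub_eq_add_neg] using (hG τ (τ - t)).comp_sub_left τ
      rw [h1, Pi.sub_apply, h2, Pi.sub_apply, h3, h5 hτ,
        intervalIntegral.integral_sub hint intervalIntegrable_const, h6,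
        indicator_of_mem (mem_Ioi.2 hτ)]
      simp
    have h2 : ((t : ℂ)⁻¹) • (shift (σ * t) f - f) - g
        = ((t : ℂ)⁻¹) • ((shift (σ * t) f - f) - (t : ℂ) • g) := by
      rw [smul_sub _ _ ((t : ℂ) • g), smul_smul, inv_mul_cancel₀ (by exact_mod_cast ht.ne'),
        one_smul]
    rw [h2, norm_smul, norm_inv, Complex.norm_real, Real.norm_of_nonneg ht.le]
    rw [inv_mul_le_iff₀ ht]
    exact h1
  rw [C0Semigroup.OrbitDeriv, Metric.tendsto_nhdsWithin_nhds]
  intro ε hε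
  have hcont := continuous_translate (zeroExt g)
  have h0 : translate 0 (zeroExt g) = zeroExt g := by
    refine Lp.ext ?_
    filter_upwards [coeFn_translate 0 (zeroExt g)] with τ h
    rw [h, add_zero]
  obtain ⟨δ, hδ, hd⟩ := Metric.continuous_iff.1 hcont 0 (ε / 2) (by positivity)
  refine ⟨δ, hδ, fun t ht htδ => ?_⟩
  have ht' : (0 : ℝ) < t := ht
  rw [NNReal.dist_eq, NNReal.coe_zero, sub_zero, abs_of_pos ht'] at htδ
  rw [dist_eq_norm]
  refine (hbound ht' (by positivity : 0 ≤ ε / 2) fun s hs => ?_).trans_lt (by linarith)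
  have h1 : dist (σ * s) 0 < δ := by
    have : |σ * s| = s := by
      rcases hσ with rfl | rfl <;> simp [abs_of_pos hs.1]
    rw [dist_zero_right, Real.norm_eq_abs, this]
    exact hs.2.trans_lt htδ
  have h2 := hd _ h1
  rw [h0, dist_eq_norm] at h2
  exact h2.le

/-- Integration over (0,b] is the inner product with an indicator function in L²; it passes norm
convergence of difference quotients to their integrals. -/
theorem continuous_intervalIntegral_Lp {b : ℝ} (hb : 0 ≤ b) :
    Continuous fun f : Lp ℂ 2 vol0 => ∫ s in 0..b, f s := by
  have hfin : vol0 (Ioc 0 b) ≠ ∞ :=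
    ((Measure.restrict_le_self _).trans_lt (by simp)).ne
  have h : (fun f : Lp ℂ 2 vol0 => ∫ s in 0..b, f s)
      = fun f => inner ℂ (indicatorConstLp 2 measurableSet_Ioc hfin (1 : ℂ)) f := by
    funext f
    rw [MeasureTheory.L2.inner_indicatorConstLp_one, intervalIntegral.integral_of_le hb,
      Measure.restrict_restrict measurableSet_Ioc,
      inter_eq_self_of_subset_left Ioc_subset_Ioi_self]
  rw [h]
  exact continuous_const.inner continuous_id

/-- Integrating a translation difference telescopes to boundary terms: increments of the primitive
of f at b and at 0. -/
theorem integral_orbit_quotient {σ : ℝ} (f : Lp ℂ 2 vol0) (t : ℝ) {b : ℝ} (hb : 0 ≤ b) :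
    ∫ s in 0..b, (((t : ℂ)⁻¹) • (shift (σ * t) f - f) : Lp ℂ 2 vol0) s
      = (t : ℂ)⁻¹ * (((∫ s in 0..(b + σ * t), zeroExt f s) - ∫ s in 0..b, zeroExt f s)
        - ∫ s in 0..(σ * t), zeroExt f s) := by
  have hI := intervalIntegrable_coeFn (zeroExt f)
  have h1 : ∫ s in 0..b, (((t : ℂ)⁻¹) • (shift (σ * t) f - f) : Lp ℂ 2 vol0) s
      = ∫ s in 0..b, (t : ℂ)⁻¹ * (zeroExt f (s + σ * t) - zeroExt f s) := by
    refine intervalIntegral.integral_congr_ae ?_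
    have e1 := (ae_restrict_iff' (μ := volume) measurableSet_Ioi).1
      (Lp.coeFn_smul ((t : ℂ)⁻¹) (shift (σ * t) f - f))
    have e2 := (ae_restrict_iff' (μ := volume) measurableSet_Ioi).1
      (Lp.coeFn_sub (shift (σ * t) f) f)
    filter_upwards [e1, e2, coeFn_shift (σ * t) f, coeFn_zeroExt f,
      ae_comp_add (coeFn_zeroExt f) (σ * t)] with s e1 e2 e3 e4 e5 hs
    rw [uIoc_of_le hb] at hs
    rw [e1 hs.1, Pi.smul_apply, e2 hs.1, Pi.sub_apply, e3 hs.1, e4, e5,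
      indicator_of_mem (mem_Ioi.2 hs.1), smul_eq_mul]
  have hI' : IntervalIntegrable (fun s => zeroExt f (s + σ * t)) volume 0 b := by
    simpa using (hI (σ * t) (b + σ * t)).comp_add_right (σ * t)
  rw [h1, intervalIntegral.integral_const_mul, intervalIntegral.integral_sub hI' (hI _ _),
    intervalIntegral.integral_comp_add_right (fun s => zeroExt f s), zero_add,
    ← intervalIntegral.integral_interval_sub_left (hI 0 _) (hI 0 _)]
  ring

/-- With N the primitive of the zero extension, the integrated quotient has an increment at b and
one at 0. For almost every b the former converges to σ f(b), so the increment at 0 converges too.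
Its limit L does not depend on b, and this gives f(b) = σL + σ∫_0^b g. -/
theorem isPrimitive_of_orbitDeriv {σ : ℝ} (hσ : σ = 1 ∨ σ = -1) {f g : Lp ℂ 2 vol0}
    (h : (shiftSemigroup σ hσ).OrbitDeriv f g) : IsPrimitive σ f g := by
  set N : ℝ → ℂ := fun x => ∫ s in 0..x, zeroExt f s with hN
  have hσ0 : σ ≠ 0 := by rcases hσ with rfl | rfl <;> norm_num
  have hσσ : (σ : ℂ) * σ = 1 := by rcases hσ with rfl | rfl <;> norm_num
  have htend : Tendsto (fun t : ℝ≥0 => σ * (t : ℝ)) (𝓝[>] 0) (𝓝[≠] 0) := by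
    refine tendsto_nhdsWithin_iff.2 ⟨?_, ?_⟩
    · have : Continuous fun t : ℝ≥0 => σ * (t : ℝ) := continuous_const.mul NNReal.continuous_coe
      simpa using (this.tendsto 0).mono_left nhdsWithin_le_nhds
    · filter_upwards [self_mem_nhdsWithin] with t ht
      exact mul_ne_zero hσ0 (by exact_mod_cast (mem_Ioi.1 ht).ne')
  have key : ∀ᵐ b : ℝ, 0 < b → Tendsto (fun t : ℝ≥0 => ((t : ℝ) : ℂ)⁻¹ * N (σ * t)) (𝓝[>] 0)
      (𝓝 (σ * f b - ∫ s in 0..b, g s)) := by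
    filter_upwards [LocallyIntegrable.ae_hasDerivAt_integral
      ((Lp.memLp (zeroExt f)).locallyIntegrable (by norm_num)), coeFn_zeroExt f]
      with b hb hfb hb0
    have h1 : Tendsto (fun t : ℝ≥0 => ((t : ℝ) : ℂ)⁻¹ * ((N (b + σ * t) - N b) - N (σ * t)))
        (𝓝[>] 0) (𝓝 (∫ s in 0..b, g s)) := by
      refine (((continuous_intervalIntegral_Lp hb0.le).tendsto g).comp h).congr fun t => ?_
      exact integral_orbit_quotient f t hb0.le
    have h2 := ((hb 0).tendsto_slope_zero.comp htend).const_mul (σ : ℂ)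
    rw [hfb, indicator_of_mem (mem_Ioi.2 hb0)] at h2
    refine (h2.sub h1).congr fun t => ?_
    simp only [Function.comp_apply, Complex.real_smul, hN]
    push_cast
    rw [mul_inv, ← mul_assoc, ← mul_assoc, mul_inv_cancel₀ (by exact_mod_cast hσ0)]
    ring
  have : (ae vol0).NeBot := ae_restrict_neBot.2 (by simp)
  -- One good point b₀ fixes the limit L; uniqueness of limits then compares it with every other
  -- good b.
  obtain ⟨b₀, hb₀, hpos⟩ := ((ae_restrict_of_ae key).and DiagCoeff.ae_pos).exists
  set L : ℂ := σ * f b₀ - ∫ s in 0..b₀, g s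
  refine ⟨σ * L, fun hs => ?_, ?_⟩
  -- For σ = -1 the increment at 0 lies where the extension is zero, so L = 0: this is the boundary
  -- condition.
  · have hz : (fun t : ℝ≥0 => ((t : ℝ) : ℂ)⁻¹ * N (σ * t)) = fun _ => 0 := by
      funext t
      have ht : (0 : ℝ) ≤ t := t.2
      have : N (σ * t) = 0 := integral_zeroExt_of_nonpos f (by rw [hs]; linarith)
      rw [this, mul_zero]
    have h0 := hb₀ hpos
    rw [hz] at h0
    rw [tendsto_nhds_unique h0 tendsto_const_nhds, mul_zero]
  · filter_upwards [key] with b hb hb0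
    have hL : L = σ * f b - ∫ s in 0..b, g s := tendsto_nhds_unique (hb₀ hpos) (hb hb0)
    rw [hL]
    linear_combination (-(f b)) * hσσ

theorem orbitDeriv_shiftSemigroup {σ : ℝ} (hσ : σ = 1 ∨ σ = -1) (f g : Lp ℂ 2 vol0) :
    (shiftSemigroup σ hσ).OrbitDeriv f g ↔ IsPrimitive σ f g :=
  ⟨isPrimitive_of_orbitDeriv hσ, IsPrimitive.orbitDeriv hσ⟩

/-! ## Reparametrisation of the half line by the travel time -/

/-- A positive continuous density `w` on `ℝ` whose primitive takes all real values. -/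
structure TravelTime where
  w : ℝ → ℝ
  cont : Continuous w
  pos : ∀ ξ, 0 < w ξ
  surj : Function.Surjective fun ξ => ∫ s in 0..ξ, w s

namespace TravelTime

variable (W : TravelTime)

theorem hasDerivAt_primitive (ξ : ℝ) : HasDerivAt (fun ξ => ∫ s in 0..ξ, W.w s) (W.w ξ) ξ :=
  W.cont.integral_hasStrictDerivAt 0 ξ |>.hasDerivAt

theorem strictMono_primitive : StrictMono fun ξ => ∫ s in 0..ξ, W.w s :=
  strictMono_of_hasDerivAt_pos W.hasDerivAt_primitive W.pos

/-- The travel time `ξ ↦ ∫_0^ξ w`, as an order isomorphism. -/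
def iso : ℝ ≃o ℝ := W.strictMono_primitive.orderIsoOfSurjective _ W.surj

theorem iso_apply (ξ : ℝ) : W.iso ξ = ∫ s in 0..ξ, W.w s := rfl

theorem iso_zero : W.iso 0 = 0 := by
  rw [iso_apply, intervalIntegral.integral_same]

theorem hasDerivAt_iso (ξ : ℝ) : HasDerivAt W.iso (W.w ξ) ξ := W.hasDerivAt_primitive ξ

/-- The travel time as a measurable equivalence. -/
def equiv : ℝ ≃ᵐ ℝ := W.iso.toHomeomorph.toMeasurableEquiv

theorem lintegral_comp (h : ℝ → ℝ≥0∞) :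
    ∫⁻ τ, h τ ∂vol0 = ∫⁻ ξ, ENNReal.ofReal (W.w ξ) * h (W.iso ξ) ∂vol0 := by
  have h1 := lintegral_image_eq_lintegral_abs_deriv_mul (s := Ioi 0) (f := W.iso) (f' := W.w)
    measurableSet_Ioi (fun ξ _ => (W.hasDerivAt_iso ξ).hasDerivWithinAt) W.iso.injective.injOn h
  rw [W.iso.image_Ioi, iso_zero] at h1
  rw [h1]
  simp_rw [abs_of_pos (W.pos _)]

theorem integral_comp (h : ℝ → ℂ) {ξ : ℝ} (hξ : 0 ≤ ξ) :
    ∫ s in 0..W.iso ξ, h s = ∫ s in 0..ξ, (W.w s : ℂ) * h (W.iso s) := by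
  have h1 := integral_image_eq_integral_abs_deriv_smul (s := Ioc 0 ξ) (f := W.iso) (f' := W.w)
    measurableSet_Ioc (fun ξ _ => (W.hasDerivAt_iso ξ).hasDerivWithinAt) W.iso.injective.injOn h
  rw [W.iso.image_Ioc, iso_zero] at h1
  have h2 : 0 ≤ W.iso ξ := by
    rw [← W.iso_zero]
    exact W.iso.monotone hξ
  rw [intervalIntegral.integral_of_le h2, intervalIntegral.integral_of_le hξ, h1]
  simp_rw [abs_of_pos (W.pos _), Complex.real_smul]

/-- The measure `w dξ` on `(0,∞)`. -/
def meas : Measure ℝ := vol0.withDensity fun ξ => ENNReal.ofReal (W.w ξ)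

theorem measurable_density : Measurable fun ξ => ENNReal.ofReal (W.w ξ) :=
  W.cont.measurable.ennreal_ofReal

theorem meas_ac : W.meas ≪ vol0 := withDensity_absolutelyContinuous _ _

theorem ac_meas : vol0 ≪ W.meas :=
  withDensity_absolutelyContinuous' W.measurable_density.aemeasurable
    (Eventually.of_forall fun ξ => by simpa using W.pos ξ)

theorem measurePreserving_equiv : MeasurePreserving W.equiv W.meas vol0 := by
  refine ⟨W.equiv.measurable, ?_⟩
  ext s hs
  have hs' : MeasurableSet (W.equiv ⁻¹' s) := W.equiv.measurable hs
  rw [Measure.map_apply W.equiv.measurable hs, meas, withDensity_apply _ hs',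
    ← lintegral_indicator_one hs, W.lintegral_comp, ← lintegral_indicator hs']
  refine lintegral_congr fun ξ => ?_
  by_cases h : W.iso ξ ∈ s
  · rw [indicator_of_mem (show ξ ∈ W.equiv ⁻¹' s from h), indicator_of_mem h, Pi.one_apply, mul_one]
  · rw [indicator_of_notMem (show ξ ∉ W.equiv ⁻¹' s from h), indicator_of_notMem h, mul_zero]

/-- The travel time preserves measure from w dξ to dτ, and w dξ has the same null sets as Lebesgue
measure because w > 0. -/
theorem ae_comp_iff {P : ℝ → Prop} :
    (∀ᵐ ξ ∂vol0, P (W.iso ξ)) ↔ ∀ᵐ τ ∂vol0, P τ := by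
  nth_rw 2 [← W.measurePreserving_equiv.map_eq]
  rw [W.equiv.measurableEmbedding.ae_map_iff]
  exact ⟨fun h => W.meas_ac.ae_le h, fun h => W.ac_meas.ae_le h⟩

theorem aestronglyMeasurable_comp {h : ℝ → ℂ} (hh : AEStronglyMeasurable h vol0) :
    AEStronglyMeasurable (fun ξ => h (W.iso ξ)) vol0 :=
  (hh.comp_measurePreserving W.measurePreserving_equiv).mono_ac W.ac_meas

theorem aestronglyMeasurable_comp_symm {h : ℝ → ℂ} (hh : AEStronglyMeasurable h vol0) :
    AEStronglyMeasurable (fun τ => h (W.iso.symm τ)) vol0 :=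
  (hh.mono_ac W.meas_ac).comp_measurePreserving
    (MeasurePreserving.symm W.equiv W.measurePreserving_equiv)

/-- A positive continuous function on `[0,∞)` whose inverse is not integrable defines a travel
time. -/
def ofSpeed (v : ℝ → ℝ) (hv : ContinuousOn v (Ici 0)) (hpos : ∀ ξ, 0 ≤ ξ → 0 < v ξ)
    (hint : ¬ IntegrableOn (fun ξ => 1 / v ξ) (Ioi 0) volume) : TravelTime where
  w ξ := (v (max ξ 0))⁻¹
  cont := (hv.comp_continuous (by fun_prop) fun ξ => le_max_right ξ 0).inv₀
    fun ξ => (hpos _ (le_max_right ξ 0)).ne'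
  pos ξ := inv_pos.2 (hpos _ (le_max_right ξ 0))
  surj := by
    set w : ℝ → ℝ := fun ξ => (v (max ξ 0))⁻¹
    have hw : Continuous w := (hv.comp_continuous (by fun_prop) fun ξ => le_max_right ξ 0).inv₀
      fun ξ => (hpos _ (le_max_right ξ 0)).ne'
    have hw0 : ∀ ξ, 0 < w ξ := fun ξ => inv_pos.2 (hpos _ (le_max_right ξ 0))
    have hd : ∀ ξ, HasDerivAt (fun ξ => ∫ s in 0..ξ, w s) (w ξ) ξ :=
      fun ξ => (hw.integral_hasStrictDerivAt 0 ξ).hasDerivAt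
    have hmono : Monotone fun ξ => ∫ s in 0..ξ, w s := (strictMono_of_hasDerivAt_pos hd hw0).monotone
    refine Continuous.surjective (continuous_iff_continuousAt.2 fun ξ => (hd ξ).continuousAt)
      ?_ ?_
    -- A bounded primitive of the positive w would make 1/v integrable on (0,∞).
    · refine tendsto_atTop_atTop_of_monotone hmono ?_
      by_contra! hb
      obtain ⟨b, hb⟩ := hb
      refine hint ?_
      have h1 : IntegrableOn w (Ioi 0) volume := by
        refine integrableOn_Ioi_of_intervalIntegral_norm_bounded b 0
          (fun ξ => (hw.integrableOn_Icc (a := 0) (b := ξ)).mono_set Ioc_subset_Icc_self)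
          tendsto_id (Eventually.of_forall fun ξ => ?_)
        simp_rw [Real.norm_of_nonneg (hw0 _).le]
        exact (hb ξ).le
      refine h1.congr_fun (fun ξ hξ => ?_) measurableSet_Ioi
      simp only [w, max_eq_left (mem_Ioi.1 hξ).le, one_div]
    -- The truncation `max ξ 0` makes w constant on the negative axis, so the primitive is linear
    -- there.
    · have h0 : (fun ξ => ∫ s in 0..ξ, w s) =ᶠ[atBot] fun ξ => w 0 * ξ := by
        filter_upwards [eventually_le_atBot (0 : ℝ)] with ξ hξ
        have : ∫ s in 0..ξ, w s = ∫ s in 0..ξ, w 0 := by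
          refine intervalIntegral.integral_congr fun s hs => ?_
          rw [uIcc_of_ge hξ] at hs
          simp only [w, max_eq_right hs.2, max_self]
        rw [this, intervalIntegral.integral_const, smul_eq_mul]
        ring
      exact (tendsto_id.const_mul_atBot (hw0 0)).congr' h0.symm

theorem ofSpeed_w {v : ℝ → ℝ} (hv : ContinuousOn v (Ici 0)) (hpos : ∀ ξ, 0 ≤ ξ → 0 < v ξ)
    (hint : ¬ IntegrableOn (fun ξ => 1 / v ξ) (Ioi 0) volume) {ξ : ℝ} (hξ : 0 ≤ ξ) :
    (ofSpeed v hv hpos hint).w ξ = (v ξ)⁻¹ := by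
  simp only [ofSpeed, max_eq_left hξ]

end TravelTime

/-! ### Signs and moduli of the diagonal entries -/

namespace DiagCoeff

variable {p q : ℕ} (D : DiagCoeff p q)

/-- The sign of the `i`-th diagonal entry of `Δ`. -/
def sgn : Idx p q → ℝ := Sum.elim (fun _ => 1) fun _ => -1

theorem sgn_cases (i : Idx p q) : sgn i = 1 ∨ sgn i = -1 := by
  rcases i with k | j
  · exact Or.inl rfl
  · exact Or.inr rfl

theorem sgn_mul_sgn (i : Idx p q) : (sgn i : ℂ) * sgn i = 1 := by
  rcases sgn_cases i with h | h <;> simp [h]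

theorem act_Delta {ξ : ℝ} (hξ : 0 ≤ ξ) (v : Idx p q → ℂ) (i : Idx p q) :
    act (D.Delta ξ) v i = sgn i * D.wt i ξ * v i := by
  have h : D.Delta ξ = Matrix.diagonal fun i => sgn i * D.wt i ξ := by
    rw [Delta, Lam, Theta, Matrix.fromBlocks_diagonal]
    congr 1
    funext i
    rcases i with k | j
    · simp [sgn, wt]
    · simp [sgn, wt, abs_of_neg (D.theta_neg j ξ hξ)]
  rw [h, act, Matrix.diagonal_map Complex.ofReal_zero, Matrix.mulVec_diagonal]
  simp

/-- The reciprocals of the diagonal entries of `Δ` are not integrable on `(0,∞)`. -/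
def NonIntegrableInv : Prop :=
  ∀ i, ¬ IntegrableOn (fun ξ => 1 / D.wt i ξ) (Ioi 0) volume

end DiagCoeff

namespace DiagCoeff

variable {p q : ℕ} {D : DiagCoeff p q}

/-! ## Diagonalisation: `L²_{|Δ|}(0,∞)` as a sum of unweighted spaces -/

/-- The travel time of the `i`-th characteristic. -/
def time (hD : D.NonIntegrableInv) (i : Idx p q) : TravelTime :=
  TravelTime.ofSpeed (D.wt i) (D.wt_cont i) (fun _ hξ => D.wt_pos i hξ) (hD i)

theorem time_w (hD : D.NonIntegrableInv) (i : Idx p q) {ξ : ℝ} (hξ : 0 ≤ ξ) :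
    (time hD i).w ξ = (D.wt i ξ)⁻¹ :=
  TravelTime.ofSpeed_w (D.wt_cont i) (fun _ hξ => D.wt_pos i hξ) (hD i) hξ

theorem wt_ne (i : Idx p q) {ξ : ℝ} (hξ : 0 ≤ ξ) : (D.wt i ξ : ℂ) ≠ 0 :=
  Complex.ofReal_ne_zero.2 (D.wt_pos i hξ).ne'

theorem rt_mul_rt (i : Idx p q) {ξ : ℝ} (hξ : 0 ≤ ξ) :
    D.rt i ξ * D.rt i ξ = (D.wt i ξ : ℂ) := by
  rw [rt, ← Complex.ofReal_mul, Real.mul_self_sqrt (D.wt_pos i hξ).le]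

/-- The Jacobian of the travel time is 1/|δ|, which equals the squared modulus of the prefactor
|δ|^{1/2} · σ/|δ|. -/
theorem eLpNorm_time (hD : D.NonIntegrableInv) (i : Idx p q) (h : ℝ → ℂ) :
    eLpNorm h 2 vol0 = eLpNorm (fun ξ =>
      D.rt i ξ * (sgn i * (D.wt i ξ : ℂ)⁻¹ * h ((time hD i).iso ξ))) 2 vol0 := by
  rw [← (ENNReal.pow_right_strictMono two_ne_zero).injective.eq_iff, eLpNorm_two_sq, eLpNorm_two_sq,
    (time hD i).lintegral_comp]
  refine lintegral_congr_ae ?_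
  filter_upwards [ae_pos] with ξ hξ
  rw [time_w hD i hξ.le]
  have hw := D.wt_pos i hξ.le
  have h1 : ‖D.rt i ξ * (sgn i * (D.wt i ξ : ℂ)⁻¹ * h ((time hD i).iso ξ))‖ ^ 2
      = (D.wt i ξ)⁻¹ * ‖h ((time hD i).iso ξ)‖ ^ 2 := by
    have h2 : ‖D.rt i ξ‖ ^ 2 = D.wt i ξ := by
      rw [sq, ← norm_mul, rt_mul_rt i hξ.le, Complex.norm_real, Real.norm_of_nonneg hw.le]
    have h3 : ‖(sgn i : ℂ)‖ = 1 := by rcases sgn_cases i with h | h <;> simp [h]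
    rw [norm_mul, norm_mul, norm_mul, norm_inv, h3, Complex.norm_real, Real.norm_of_nonneg hw.le,
      mul_pow, h2]
    field_simp
  rw [← ofReal_norm, ← ofReal_norm, ← ENNReal.ofReal_pow (norm_nonneg _),
    ← ENNReal.ofReal_pow (norm_nonneg _), h1, ENNReal.ofReal_mul (inv_nonneg.2 hw.le)]

theorem aestronglyMeasurable_wt (i : Idx p q) :
    AEStronglyMeasurable (fun ξ => (D.wt i ξ : ℂ)) vol0 :=
  ((Complex.continuous_ofReal.comp_continuousOn (D.wt_cont i)).mono
    Ioi_subset_Ici_self).aestronglyMeasurable measurableSet_Ioi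

/-- The `i`-th component of `Δ x` as a function of the travel time. -/
def charFun (hD : D.NonIntegrableInv) (x : D.L2) (i : Idx p q) (τ : ℝ) : ℂ :=
  sgn i * D.wt i ((time hD i).iso.symm τ) * D.fn x ((time hD i).iso.symm τ) i

theorem charFun_iso (hD : D.NonIntegrableInv) (x : D.L2) (i : Idx p q) (ξ : ℝ) :
    charFun hD x i ((time hD i).iso ξ) = sgn i * D.wt i ξ * D.fn x ξ i := by
  rw [charFun, OrderIso.symm_apply_apply]

theorem eLpNorm_charFun (hD : D.NonIntegrableInv) (x : D.L2) (i : Idx p q) :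
    eLpNorm (charFun hD x i) 2 vol0 = eLpNorm (fun ξ => D.rt i ξ * D.fn x ξ i) 2 vol0 := by
  rw [eLpNorm_time hD i]
  refine eLpNorm_congr_ae ?_
  filter_upwards [ae_pos] with ξ hξ
  rw [charFun_iso]
  have h1 := wt_ne (D := D) i hξ.le
  have h2 := sgn_mul_sgn i
  field_simp
  linear_combination (D.rt i ξ * D.fn x ξ i) * h2

theorem memLp_charFun (hD : D.NonIntegrableInv) (x : D.L2) (i : Idx p q) :
    MemLp (charFun hD x i) 2 vol0 := by
  refine ⟨?_, ?_⟩
  · refine (time hD i).aestronglyMeasurable_comp_symm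
      (h := fun ξ => sgn i * D.wt i ξ * D.fn x ξ i) ?_
    exact ((aestronglyMeasurable_wt i).const_mul (sgn i : ℂ)).mul
      ((continuous_apply i).comp_aestronglyMeasurable x.1.aestronglyMeasurable)
  · rw [eLpNorm_charFun]
    exact (D.memLp_fn x i).2

theorem coeFn_toLp_charFun (hD : D.NonIntegrableInv) (x : D.L2) (i : Idx p q) :
    ∀ᵐ ξ ∂vol0, (memLp_charFun hD x i).toLp _ ((time hD i).iso ξ)
      = sgn i * D.wt i ξ * D.fn x ξ i := by
  filter_upwards [(time hD i).ae_comp_iff.2 (memLp_charFun hD x i).coeFn_toLp] with ξ h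
  rw [h, charFun_iso]

theorem Lp_ext_time (hD : D.NonIntegrableInv) (i : Idx p q) {f g : Lp ℂ 2 vol0}
    (h : ∀ᵐ ξ ∂vol0, f ((time hD i).iso ξ) = g ((time hD i).iso ξ)) : f = g :=
  Lp.ext ((time hD i).ae_comp_iff.1 h)

/-- The map `x ↦ Δ x`, each component being written as a function of its travel time. -/
def charMap (hD : D.NonIntegrableInv) : D.L2 →ₗ[ℂ] Idx p q → Lp ℂ 2 vol0 where
  toFun x i := (memLp_charFun hD x i).toLp _
  map_add' x y := by
    funext i
    refine Lp_ext_time hD i ?_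
    filter_upwards [coeFn_toLp_charFun hD (x + y) i, coeFn_toLp_charFun hD x i,
      coeFn_toLp_charFun hD y i, (time hD i).ae_comp_iff.2
        (Lp.coeFn_add ((memLp_charFun hD x i).toLp _) ((memLp_charFun hD y i).toLp _)),
      D.fn_add x y] with ξ h1 h2 h3 h4 h5
    rw [h1, Pi.add_apply, h4, Pi.add_apply, h2, h3, h5, Pi.add_apply, mul_add]
  map_smul' c x := by
    funext i
    refine Lp_ext_time hD i ?_
    filter_upwards [coeFn_toLp_charFun hD (c • x) i, coeFn_toLp_charFun hD x i,
      (time hD i).ae_comp_iff.2 (Lp.coeFn_smul c ((memLp_charFun hD x i).toLp _)),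
      D.fn_smul c x] with ξ h1 h2 h4 h5
    simp only [RingHom.id_apply]
    rw [h1, Pi.smul_apply, h4, Pi.smul_apply, h2, h5, Pi.smul_apply, smul_eq_mul, smul_eq_mul,
      mul_left_comm]

theorem coeFn_charMap (hD : D.NonIntegrableInv) (x : D.L2) (i : Idx p q) :
    ∀ᵐ ξ ∂vol0, charMap hD x i ((time hD i).iso ξ) = sgn i * D.wt i ξ * D.fn x ξ i :=
  coeFn_toLp_charFun hD x i

theorem norm_charMap_le (hD : D.NonIntegrableInv) (x : D.L2) : ‖charMap hD x‖ ≤ ‖x‖ := by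
  refine (pi_norm_le_iff_of_nonneg (norm_nonneg x)).2 fun i => ?_
  rw [← D.norm_sqrtMap x]
  refine le_trans (le_of_eq ?_) (PiLp.norm_apply_le (D.sqrtMap x) i)
  have h1 : ‖charMap hD x i‖ = (eLpNorm (charFun hD x i) 2 vol0).toReal :=
    Lp.norm_toLp _ (memLp_charFun hD x i)
  have h2 : ‖D.sqrtMap x i‖ = (eLpNorm (fun ξ => D.rt i ξ * D.fn x ξ i) 2 vol0).toReal :=
    Lp.norm_toLp _ (D.memLp_fn x i)
  rw [h1, h2, eLpNorm_charFun]

theorem charMap_injective (hD : D.NonIntegrableInv) : Function.Injective (charMap hD) := by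
  refine (injective_iff_map_eq_zero _).2 fun x hx => D.ext_ae ?_
  have h : ∀ i, ∀ᵐ ξ ∂vol0, D.fn x ξ i = 0 := by
    intro i
    filter_upwards [coeFn_charMap hD x i, ae_pos,
      (time hD i).ae_comp_iff.2 (Lp.coeFn_zero ℂ 2 vol0)] with ξ h1 hξ h2
    rw [hx, Pi.zero_apply, h2, Pi.zero_apply] at h1
    have h3 : (sgn i : ℂ) ≠ 0 := left_ne_zero_of_mul_eq_one (sgn_mul_sgn i)
    simpa [h3, wt_ne i hξ.le] using h1.symm
  filter_upwards [ae_all_iff.2 h, D.fn_zero] with ξ h1 h2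
  rw [h2]
  funext i
  exact h1 i

theorem charMap_surjective (hD : D.NonIntegrableInv) : Function.Surjective (charMap hD) := by
  intro g
  have hm : ∀ i, MemLp (fun ξ => D.rt i ξ *
      (sgn i * (D.wt i ξ : ℂ)⁻¹ * g i ((time hD i).iso ξ))) 2 vol0 := by
    intro i
    refine ⟨?_, ?_⟩
    · exact (D.rt_aesm i).mul ((((aestronglyMeasurable_wt i).aemeasurable.inv.aestronglyMeasurable
        ).const_mul (sgn i : ℂ)).mul
          ((time hD i).aestronglyMeasurable_comp (Lp.aestronglyMeasurable (g i))))
    · rw [← eLpNorm_time hD i]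
      exact (Lp.memLp (g i)).2
  -- The preimage has components σ |δ|⁻¹ g_i(τ(ξ)); surjectivity of `sqrtMap` supplies it as an
  -- element of the weighted space.
  obtain ⟨x, hx⟩ := D.sqrtMap_surjective (WithLp.toLp 2 fun i => (hm i).toLp _)
  refine ⟨x, funext fun i => Lp_ext_time hD i ?_⟩
  have hxi : (D.memLp_fn x i).toLp _ = (hm i).toLp _ :=
    congrArg (fun f : PiLp 2 (fun _ : Idx p q => Lp ℂ 2 vol0) => f i) hx
  filter_upwards [coeFn_charMap hD x i, ae_pos, (MemLp.toLp_eq_toLp_iff _ _).1 hxi]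
    with ξ h1 hξ h2
  rw [h1, mul_left_cancel₀ (D.rt_ne i hξ.le) h2]
  have h3 := wt_ne (D := D) i hξ.le
  field_simp
  linear_combination (g i ((time hD i).iso ξ)) * sgn_mul_sgn i

/-- `charMap` as a continuous linear equivalence. -/
def charEquiv (hD : D.NonIntegrableInv) : D.L2 ≃L[ℂ] (Idx p q → Lp ℂ 2 vol0) :=
  (LinearEquiv.ofBijective (charMap hD)
    ⟨charMap_injective hD, charMap_surjective hD⟩).toContinuousLinearEquivOfContinuous
      ((charMap hD).mkContinuous 1 fun x => by
        rw [one_mul]; exact norm_charMap_le hD x).continuous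

theorem charEquiv_apply (hD : D.NonIntegrableInv) (x : D.L2) (i : Idx p q) :
    charEquiv hD x i = charMap hD x i := rfl

/-- Substituting τ = τ(ξ) in the integral, the Jacobian 1/|δ| cancels |δ| and leaves σ z_i; this σ
meets the one in `IsPrimitive`, and σ² = 1. -/
theorem isPrimitive_charEquiv (hD : D.NonIntegrableInv) (x z : D.L2) (i : Idx p q) :
    IsPrimitive (sgn i) (charEquiv hD x i) (charEquiv hD z i) ↔
      ∃ c : ℂ, (sgn i = -1 → c = 0) ∧
        ∀ᵐ ξ ∂vol0, act (D.Delta ξ) (D.fn x ξ) i = c + ∫ s in 0..ξ, D.fn z s i := by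
  unfold IsPrimitive
  refine exists_congr fun c => and_congr_right fun _ => ?_
  simp only [charEquiv_apply]
  have h1 : (∀ᵐ τ : ℝ, 0 < τ →
      charMap hD x i τ = c + sgn i * ∫ s in 0..τ, charMap hD z i s) ↔
      ∀ᵐ τ ∂vol0, charMap hD x i τ = c + sgn i * ∫ s in 0..τ, charMap hD z i s :=
    (ae_restrict_iff' measurableSet_Ioi).symm
  rw [h1, ← (time hD i).ae_comp_iff]
  refine eventually_congr ?_
  have hz := (ae_restrict_iff' (μ := volume) measurableSet_Ioi).1 (coeFn_charMap hD z i)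
  filter_upwards [coeFn_charMap hD x i, ae_pos] with ξ hx hξ
  have h2 : ∫ s in 0..(time hD i).iso ξ, charMap hD z i s
      = sgn i * ∫ s in 0..ξ, D.fn z s i := by
    rw [(time hD i).integral_comp _ hξ.le, ← intervalIntegral.integral_const_mul]
    refine intervalIntegral.integral_congr_ae ?_
    filter_upwards [hz] with s hs hs'
    rw [uIoc_of_le hξ.le] at hs'
    rw [hs hs'.1, time_w hD i hs'.1.le]
    have h3 := wt_ne (D := D) i hs'.1.le
    push_cast
    field_simp
  rw [hx, h2, ← mul_assoc, sgn_mul_sgn, one_mul, D.act_Delta hξ.le]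

/-! ## Characterisation of the operator by primitives -/

/-- |Δ|^{1/2} z is in L², hence integrable on bounded intervals, and the entries of |Δ|^{-1/2} are
continuous on the compact [0,b]. -/
theorem intervalIntegrable_fn (z : D.L2) {b : ℝ} (hb : 0 ≤ b) :
    IntervalIntegrable (D.fn z) volume 0 b := by
  rw [intervalIntegrable_iff_integrableOn_Ioc_of_le hb, IntegrableOn]
  refine Integrable.of_eval fun i => ?_
  have hv : volume.restrict (Ioc 0 b) ≤ vol0 := Measure.restrict_mono_set _ Ioc_subset_Ioi_self
  have h1 : Integrable (fun ξ => D.rt i ξ * D.fn z ξ i) (volume.restrict (Ioc 0 b)) :=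
    ((D.memLp_fn z i).mono_measure hv).integrable (by norm_num)
  have hc : ContinuousOn (fun ξ => (D.rt i ξ)⁻¹) (Icc 0 b) := by
    refine ContinuousOn.inv₀ ?_ fun ξ hξ => D.rt_ne i hξ.1
    exact (Complex.continuous_ofReal.comp_continuousOn
      (Real.continuous_sqrt.comp_continuousOn (D.wt_cont i))).mono Icc_subset_Ici_self
  have h2 : IntegrableOn (fun ξ => (D.rt i ξ)⁻¹ * (D.rt i ξ * D.fn z ξ i)) (Icc 0 b) volume :=
    IntegrableOn.continuousOn_mul hc
      ((integrableOn_Icc_iff_integrableOn_Ioc).2 h1) isCompact_Icc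
  refine (h2.mono_set Ioc_subset_Icc_self).congr_fun (fun ξ hξ => ?_) measurableSet_Ioc
  simp only
  rw [inv_mul_cancel_left₀ (D.rt_ne i hξ.1.le)]

theorem intervalIntegral_apply (z : D.L2) {b : ℝ} (hb : 0 ≤ b) (i : Idx p q) :
    (∫ s in 0..b, D.fn z s) i = ∫ s in 0..b, D.fn z s i :=
  ((ContinuousLinearMap.proj (R := ℂ) (φ := fun _ : Idx p q => ℂ) i).intervalIntegral_comp_comm
    (intervalIntegrable_fn z hb)).symm

end DiagCoeff

/-! ### Absolute continuity by domination, and integrals of vector-valued functions -/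

theorem absolutelyContinuousOnInterval_of_dist_le {X Y : Type*} [PseudoMetricSpace X]
    [PseudoMetricSpace Y] {f : ℝ → X} {g : ℝ → Y} {a b : ℝ}
    (hg : AbsolutelyContinuousOnInterval g a b)
    (h : ∀ s ∈ uIcc a b, ∀ t ∈ uIcc a b, dist (f s) (f t) ≤ dist (g s) (g t)) :
    AbsolutelyContinuousOnInterval f a b := by
  rw [absolutelyContinuousOnInterval_iff] at hg ⊢
  intro ε hε
  obtain ⟨δ, hδ, hd⟩ := hg ε hε
  refine ⟨δ, hδ, fun E hE hEδ => (Finset.sum_le_sum fun i hi => ?_).trans_lt (hd E hE hEδ)⟩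
  have := hE.1 i hi
  exact h _ this.1 _ this.2

/-- The increments are dominated by those of the scalar integral of ‖f‖. -/
theorem absolutelyContinuousOnInterval_integral {E : Type*} [NormedAddCommGroup E]
    [NormedSpace ℝ E] {f : ℝ → E} {a b c : ℝ}
    (hf : IntervalIntegrable f volume a b) (hc : c ∈ uIcc a b) :
    AbsolutelyContinuousOnInterval (fun x => ∫ s in c..x, f s) a b := by
  refine absolutelyContinuousOnInterval_of_dist_le
    (hf.norm.absolutelyContinuousOnInterval_intervalIntegral hc) fun s hs t ht => ?_
  have hi : ∀ x ∈ uIcc a b, IntervalIntegrable f volume c x := fun x hx =>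
    hf.mono_set (uIcc_subset_uIcc hc hx)
  rw [dist_eq_norm, dist_eq_norm,
    intervalIntegral.integral_interval_sub_left (hi s hs) (hi t ht),
    intervalIntegral.integral_interval_sub_left (hi s hs).norm (hi t ht).norm, Real.norm_eq_abs]
  exact intervalIntegral.norm_integral_le_abs_integral_norm

namespace DiagCoeff

variable {p q : ℕ} {D : DiagCoeff p q}

theorem acLoc_integral_fn (z : D.L2) : ACLoc fun ξ => ∫ s in 0..ξ, D.fn z s := by
  intro a b ha hab
  have h := absolutelyContinuousOnInterval_integral (intervalIntegrable_fn z (ha.trans hab))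
    left_mem_uIcc
  refine h.mono ?_
  rw [uIcc_of_le hab, uIcc_of_le (ha.trans hab)]
  exact Icc_subset_Icc_left ha

theorem ae_hasDerivAt_integral_fn (z : D.L2) :
    ∀ᵐ ξ ∂vol0, HasDerivAt (fun ξ => ∫ s in 0..ξ, D.fn z s) (D.fn z ξ) ξ := by
  -- Lebesgue differentiation on each [0,n]; the countably many exceptional null sets are then
  -- merged.
  have h : ∀ n : ℕ, ∀ᵐ ξ, ξ ∈ uIcc (0 : ℝ) n → ∀ c ∈ uIcc (0 : ℝ) n,
      HasDerivAt (fun ξ => ∫ s in c..ξ, D.fn z s) (D.fn z ξ) ξ := fun n =>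
    (intervalIntegrable_fn z n.cast_nonneg).ae_hasDerivAt_integral
  filter_upwards [ae_restrict_of_ae (ae_all_iff.2 h), ae_pos] with ξ h hξ
  obtain ⟨n, hn⟩ := exists_nat_ge ξ
  refine h n ?_ 0 left_mem_uIcc
  rw [uIcc_of_le (hξ.le.trans hn)]
  exact ⟨hξ.le, hn⟩

/-- The difference of y and the integral is absolutely continuous with zero derivative almost
everywhere, hence constant. -/
theorem IsDerivVia.eq_integral {x z : D.L2} {y : ℝ → Idx p q → ℂ} (h : D.IsDerivVia x z y)
    {ξ : ℝ} (hξ : 0 ≤ ξ) : y ξ = y 0 + ∫ s in 0..ξ, D.fn z s := by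
  have hac : AbsolutelyContinuousOnInterval (y - fun ξ => ∫ s in 0..ξ, D.fn z s) 0 ξ :=
    (h.1 0 ξ le_rfl hξ).sub (acLoc_integral_fn z 0 ξ le_rfl hξ)
  have h1 := (ae_restrict_iff' (μ := volume) measurableSet_Ioi).1 h.2.2.1
  have h2 := (ae_restrict_iff' (μ := volume) measurableSet_Ioi).1 (ae_hasDerivAt_integral_fn z)
  -- The derivatives are known almost everywhere on the open half line only, so the endpoint 0 is
  -- discarded as a null set.
  have h3 : ∀ᵐ s : ℝ, s ≠ 0 := by simp [ae_iff, measure_singleton]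
  obtain ⟨C, hC⟩ := hac.const_of_ae_hasDerivAt_zero (by
    filter_upwards [h1, h2, h3] with s h1 h2 h3 hs
    rw [uIcc_of_le hξ] at hs
    have hs0 : s ∈ Ioi (0 : ℝ) := lt_of_le_of_ne hs.1 (Ne.symm h3)
    simpa using (h1 hs0).sub (h2 hs0))
  have e0 := hC 0 left_mem_uIcc
  have e1 := hC ξ right_mem_uIcc
  simp only [Pi.sub_apply, intervalIntegral.integral_same, sub_zero] at e0 e1
  rw [e0, ← e1, sub_add_cancel]

/-- The constants c_i are the components of y(0), and conversely y = c + ∫_0^ξ z is the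
representative. The problem is thereby split into scalar ones. -/
theorem exists_isDerivVia_iff (x z : D.L2) :
    (∃ y, D.IsDerivVia x z y) ↔ ∀ i, ∃ c : ℂ, (sgn i = -1 → c = 0) ∧
      ∀ᵐ ξ ∂vol0, act (D.Delta ξ) (D.fn x ξ) i = c + ∫ s in 0..ξ, D.fn z s i := by
  constructor
  · rintro ⟨y, h⟩ i
    refine ⟨y 0 i, fun hi => ?_, ?_⟩
    · rcases i with k | j
      · norm_num [sgn] at hi
      · exact h.2.2.2 j
    · filter_upwards [h.2.1, ae_pos] with ξ h1 hξ
      rw [← h1, h.eq_integral hξ.le, Pi.add_apply, intervalIntegral_apply z hξ.le]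
  · intro h
    choose c hc h using h
    refine ⟨fun ξ => c + ∫ s in 0..ξ, D.fn z s, fun a b ha hab => ?_, ?_, ?_, fun j => ?_⟩
    · exact absolutelyContinuousOnInterval_of_dist_le (acLoc_integral_fn z a b ha hab)
        fun s _ t _ => (dist_add_left _ _ _).le
    · filter_upwards [ae_all_iff.2 h, ae_pos] with ξ h1 hξ
      funext i
      rw [h1 i, Pi.add_apply, intervalIntegral_apply z hξ.le]
    · filter_upwards [ae_hasDerivAt_integral_fn z] with ξ h1
      exact h1.const_add c
    · simp only [intervalIntegral.integral_same, add_zero]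
      exact hc (Sum.inr j) rfl

/-- If the travel times of all characteristics are infinite, `A_Δ` generates a semigroup. -/
theorem generates_opA (hD : D.NonIntegrableInv) : GeneratesC0Semigroup D.opA := by
  refine ⟨(C0Semigroup.pi fun i => shiftSemigroup (sgn i) (sgn_cases i)).conj (charEquiv hD),
    fun x z => ?_⟩
  rw [D.opA_iff, exists_isDerivVia_iff]
  refine Iff.trans ?_ (C0Semigroup.orbitDeriv_conj (charEquiv hD) _ x z).symm
  rw [C0Semigroup.orbitDeriv_pi]
  refine forall_congr' fun i => ?_
  rw [orbitDeriv_shiftSemigroup, isPrimitive_charEquiv]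

end DiagCoeff

end DiagTransport

end

theorem proposition4p5 (np nm : ℕ) (hnp : 1 ≤ np) (hnm : 1 ≤ nm)
    (lam : Fin np → ℝ → ℝ) (theta : Fin nm → ℝ → ℝ)
    (lam_cont : ∀ k, ContinuousOn (lam k) (Set.Ici 0))
    (theta_cont : ∀ j, ContinuousOn (theta j) (Set.Ici 0))
    (lam_pos : ∀ k, ∀ ξ ∈ Set.Ici (0 : ℝ), 0 < lam k ξ)
    (theta_neg : ∀ j, ∀ ξ ∈ Set.Ici (0 : ℝ), theta j ξ < 0)
    (lam_inv : ∀ k, ¬ MeasureTheory.IntegrableOn (fun ξ => 1 / lam k ξ) (Set.Ioi 0)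
      MeasureTheory.volume)
    (theta_inv : ∀ j, ¬ MeasureTheory.IntegrableOn (fun ξ => 1 / theta j ξ) (Set.Ioi 0)
      MeasureTheory.volume) :
    DiagTransport.GeneratesC0Semigroup
      (DiagTransport.DiagCoeff.opA
        (⟨lam, theta, lam_cont, theta_cont, lam_pos, theta_neg⟩ :
          DiagTransport.DiagCoeff np nm)) := by
  refine DiagTransport.DiagCoeff.generates_opA fun i => ?_
  rcases i with k | j
  · exact lam_inv k
  -- On (0,∞) one has 1/θ = -(1/|θ|), so integrability of 1/|θ| would give that of 1/θ.
  · refine fun h => theta_inv j ((h.neg).congr_fun (fun ξ hξ => ?_) measurableSet_Ioi)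
    have hneg := theta_neg j ξ (Set.Ioi_subset_Ici_self hξ)
    simp only [DiagTransport.DiagCoeff.wt, Sum.elim_inr, Pi.neg_apply, abs_of_neg hneg]
    rw [one_div, one_div, inv_neg, neg_neg]
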